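/- Let $Q\subset\mathbb{R}^3$ be a bounded open set with Lipschitz boundary (for instance, a domain contained in a fluid region $\Omega_f$; connectedness of $Q$ is not needed), that is, near each point of $\partial Q$, in suitable orthonormal coordinates, $Q$ is the set of points lying strictly below the graph of a Lipschitz function. Let $n=(n_1,n_2,n_3)$ be the outward unit normal, defined almost everywhere on $\partial Q$ with respect to surface area. Let $\bar w=(\bar w_1,\bar w_2,\bar w_3)\in C^1(\overline{Q};\mathbb{R}^3)$ (a steady advection velocity) and $\tilde u=(\tilde u_1,\tilde u_2,\tilde u_3)\in C^2(\overline{Q};\mathbb{R}^3)$ (an acoustic velocity fluctuation at a fixed time); at boundary points, derivatives are taken from within $\overline Q$. Then all the integrands below are integrable and, with summation over the repeated indices $i,k\in\{1,2,3\}$, $$\int_Q \partial_k \bar w_i\,\partial_i \tilde u_k\,dx = \int_{\partial Q}\bigl(\bar w_i\,\partial_i\tilde u_k-\bar w_k\,\partial_i\tilde u_i\bigr)n_k\,dS+\int_Q(\nabla\cdot\bar w)(\nabla\cdot\tilde u)\,dx,$$ where $dS$ is the surface area measure on $\partial Q$. -/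

import Mathlib

open MeasureTheory Metric Set Filter Topology

noncomputable section

namespace Acoustic

/-- The plane with its Euclidean norm. -/
abbrev E2 := EuclideanSpace ℝ (Fin 2)

/-- Three-dimensional space with its Euclidean norm. -/
abbrev E3 := EuclideanSpace ℝ (Fin 3)

/-- The boundary of `Q` is Lipschitz: near each boundary point, in suitable orthonormal
coordinates, `Q` is the set of points strictly below the graph of a Lipschitz function. -/
def HasLipschitzBoundary (Q : Set E3) : Prop :=
  ∀ x ∈ frontier Q, ∃ (R : E3 ≃ₗᵢ[ℝ] E3) (K : NNReal) (g : E2 → ℝ), LipschitzWith K g ∧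
    ∀ᶠ y in 𝓝 x, (y ∈ Q ↔ R y 2 < g !₂[R y 0, R y 1])

/-- `ν` is the outward unit normal to `Q` at `x`: for every `ε > 0`, close to `x` the points `y`
with `⟪y - x, ν⟫ > ε ‖y - x‖` lie outside `Q` and those with `⟪y - x, ν⟫ < -ε ‖y - x‖` lie in `Q`.
At a point of the graph bounding `Q` this is the usual normal
`(-∇g, 1) / √(1 + |∇g|²)` wherever `g` is differentiable. -/
def IsOuterUnitNormal (Q : Set E3) (x ν : E3) : Prop :=
  ‖ν‖ = 1 ∧ ∀ ε : ℝ, 0 < ε → ∀ᶠ y in 𝓝 x,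
    (ε * ‖y - x‖ < inner ℝ (y - x) ν → y ∉ Q) ∧
    (inner ℝ (y - x) ν < -(ε * ‖y - x‖) → y ∈ Q)

/-- The outward unit normal at a point is unique. -/
theorem IsOuterUnitNormal.unique {Q : Set E3} {x ν ν' : E3}
    (h : IsOuterUnitNormal Q x ν) (h' : IsOuterUnitNormal Q x ν') : ν = ν' := by
  by_contra hne
  have hv : 0 < ‖ν - ν'‖ := norm_pos_iff.mpr (sub_ne_zero.mpr hne)
  have hsq : ‖ν - ν'‖ ^ 2 = 2 * (1 - inner ℝ ν ν') := by
    rw [norm_sub_sq_real, h.1, h'.1]; ring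
  have h1 : inner ℝ (ν - ν') ν = ‖ν - ν'‖ ^ 2 / 2 := by
    rw [hsq, inner_sub_left, real_inner_self_eq_norm_sq, h.1, real_inner_comm]; ring
  have h2 : inner ℝ (ν - ν') ν' = -(‖ν - ν'‖ ^ 2 / 2) := by
    rw [hsq, inner_sub_left, real_inner_self_eq_norm_sq, h'.1]; ring
  have hε : 0 < ‖ν - ν'‖ / 4 := by positivity
  have ht : Tendsto (fun t : ℝ => x + t • (ν - ν')) (𝓝[>] 0) (𝓝 x) := by
    have : Continuous fun t : ℝ => x + t • (ν - ν') := by fun_prop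
    simpa using (this.tendsto 0).mono_left nhdsWithin_le_nhds
  have key := (ht.eventually ((h.2 _ hε).and (h'.2 _ hε))).and self_mem_nhdsWithin
  obtain ⟨t, ⟨⟨ha, -⟩, -, hb⟩, ht0⟩ := key.exists
  have ht0 : 0 < t := ht0
  have hp : 0 < t * ‖ν - ν'‖ ^ 2 := by positivity
  simp only [add_sub_cancel_left, inner_smul_left, norm_smul, Real.norm_eq_abs, abs_of_pos ht0,
    h1, h2, conj_trivial] at ha hb
  exact ha (by nlinarith) (hb (by nlinarith))

open Classical in
/-- The outward unit normal field `n` on the boundary of `Q`, set to `0` at the points without a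
normal (for a Lipschitz boundary, these form a set of zero area). -/
def outerNormal (Q : Set E3) (x : E3) : E3 :=
  if h : ∃ ν, IsOuterUnitNormal Q x ν then h.choose else 0

/-- The partial derivative `∂ᵢ f` at `x` of a function on the closed region `A`, one-sided at
boundary points of `A`. -/
def pd (A : Set E3) (i : Fin 3) (f : E3 → ℝ) (x : E3) : ℝ :=
  fderivWithin ℝ f A x (EuclideanSpace.single i 1)

/-- At interior points, `pd` is the ordinary partial derivative. -/
theorem pd_eq_fderiv {A : Set E3} {x : E3} (hx : x ∈ interior A) (i : Fin 3) (f : E3 → ℝ) :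
    pd A i f x = fderiv ℝ f x (EuclideanSpace.single i 1) := by
  rw [pd, fderivWithin_of_mem_nhds (mem_interior_iff_mem_nhds.mp hx)]

/-- The divergence `∇ · v = ∂ᵢ vᵢ`. -/
def divg (A : Set E3) (v : E3 → E3) (x : E3) : ℝ :=
  ∑ i, pd A i (fun y => v y i) x

end Acoustic

end

/-! The field with components `F_k = w_i ∂_i u_k - w_k ∂_i u_i` (`fluxField`) has divergence `∂_k
w_i ∂_i u_k - (∇ · w)(∇ · u)`: the second-order terms `w_i ∂_k ∂_i u_k` and `w_k ∂_k ∂_i u_i` cancel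
after exchanging indices, by symmetry of second derivatives (`sum_fderiv_fluxField`). Since `F` is
C¹ up to the boundary, the identity is the divergence theorem for `F`.

That theorem (`integral_fderiv_eq_integral_frontier`) is proved by a partition of unity. A piece
supported inside `Q` contributes zero on both sides. A piece near the boundary reduces to the region
below a Lipschitz graph (`integral_below_fderiv`): the shear `(y, s) ↦ (y, g y + s)` preserves
volume and turns the region into a half-space. On each slice `s < 0`, a derivative along the graph
has zero integral, so `∂_v G` may be replaced by `fluxDensity g v` times the vertical derivative,
which is then integrated in `s`. Neither `g` nor the domain has to be smoothed.

To read the result as a surface integral, the area formula for graphs (`measure_graph_image`)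
identifies the surface measure with density `√(1 + |∇g|²)`, and Rademacher's theorem supplies the
outward normal almost everywhere. -/

noncomputable section

namespace Acoustic

open scoped Manifold ContDiff

/-! ### Horizontal-vertical splitting of space and graph coordinates. -/

/-- The vertical unit vector. -/
def vert : E3 := EuclideanSpace.single 2 1

/-- The inclusion of the plane as the horizontal plane. -/
def lift : E2 →L[ℝ] E3 :=
  LinearMap.toContinuousLinearMap
    { toFun := fun y => !₂[y 0, y 1, 0]
      map_add' := fun x y => by ext i; fin_cases i <;> simp
      map_smul' := fun c x => by ext i; fin_cases i <;> simp }

/-- The projection of space onto its horizontal plane. -/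
def proj : E3 →L[ℝ] E2 :=
  LinearMap.toContinuousLinearMap
    { toFun := fun z => !₂[z 0, z 1]
      map_add' := fun x y => by ext i; fin_cases i <;> simp
      map_smul' := fun c x => by ext i; fin_cases i <;> simp }

theorem proj_eq (z : E3) : proj z = !₂[z 0, z 1] := rfl

theorem lift_eq (y : E2) : lift y = !₂[y 0, y 1, 0] := rfl

@[simp] theorem proj_lift (y : E2) : proj (lift y) = y := by
  ext i; fin_cases i <;> simp [proj_eq, lift_eq]

@[simp] theorem proj_vert : proj vert = 0 := by
  ext i; fin_cases i <;> simp [proj_eq, vert]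

@[simp] theorem lift_apply_two (y : E2) : lift y 2 = 0 := by simp [lift_eq]

@[simp] theorem vert_apply_two : vert 2 = 1 := by simp [vert]

theorem lift_proj_add (z : E3) : lift (proj z) + z 2 • vert = z := by
  ext i; fin_cases i <;> simp [proj_eq, lift_eq, vert]

theorem inner_lift_add_vert (a b : E2) (s t : ℝ) :
    inner ℝ (lift a + s • vert) (lift b + t • vert) = inner ℝ a b + s * t := by
  simp [PiLp.inner_apply, Fin.sum_univ_three, lift_eq, vert, mul_comm]

theorem norm_sq_lift_add_vert (a : E2) (t : ℝ) :
    ‖lift a + t • vert‖ ^ 2 = ‖a‖ ^ 2 + t ^ 2 := by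
  rw [← real_inner_self_eq_norm_sq, inner_lift_add_vert, real_inner_self_eq_norm_sq]; ring

theorem norm_le_norm_lift_add_vert (a : E2) (t : ℝ) : ‖a‖ ≤ ‖lift a + t • vert‖ := by
  refine le_of_sq_le_sq ?_ (norm_nonneg _)
  rw [norm_sq_lift_add_vert]; nlinarith [sq_nonneg t]

theorem norm_lift_add_vert_le (a : E2) (t : ℝ) : ‖lift a + t • vert‖ ≤ ‖a‖ + |t| := by
  refine le_of_sq_le_sq ?_ (by positivity)
  rw [norm_sq_lift_add_vert]
  nlinarith [norm_nonneg a, abs_nonneg t, sq_abs t]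

theorem norm_proj_le (z : E3) : ‖proj z‖ ≤ ‖z‖ := by
  conv_rhs => rw [← lift_proj_add z]
  exact norm_le_norm_lift_add_vert _ _

@[simp] theorem norm_vert : ‖vert‖ = 1 := by simp [vert]

/-- The parametrization of the graph of `g` by the plane. -/
def graphMap (g : E2 → ℝ) (y : E2) : E3 := lift y + g y • vert

@[simp] theorem proj_graphMap (g : E2 → ℝ) (y : E2) : proj (graphMap g y) = y := by
  simp [graphMap]

@[simp] theorem graphMap_apply_two (g : E2 → ℝ) (y : E2) : graphMap g y 2 = g y := by
  simp [graphMap]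

theorem graphMap_sub (g : E2 → ℝ) (x y : E2) :
    graphMap g x - graphMap g y = lift (x - y) + (g x - g y) • vert := by
  simp only [graphMap, map_sub, sub_smul]; abel

theorem graphMap_injective (g : E2 → ℝ) : Function.Injective (graphMap g) :=
  Function.LeftInverse.injective (g := proj) (proj_graphMap g)

theorem mem_range_graphMap {g : E2 → ℝ} {z : E3} :
    z ∈ range (graphMap g) ↔ z 2 = g (proj z) := by
  constructor
  · rintro ⟨y, rfl⟩; simp
  · intro h
    exact ⟨proj z, by rw [graphMap, ← h, lift_proj_add]⟩

theorem continuous_graphMap {g : E2 → ℝ} (hg : Continuous g) : Continuous (graphMap g) := by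
  unfold graphMap; fun_prop

theorem isClosedEmbedding_graphMap {g : E2 → ℝ} (hg : Continuous g) :
    IsClosedEmbedding (graphMap g) := by
  refine ⟨.of_leftInverse (f := proj) (proj_graphMap g) proj.continuous (continuous_graphMap hg), ?_⟩
  have : range (graphMap g) = {z : E3 | z 2 = g (proj z)} := by
    ext z; exact mem_range_graphMap
  rw [this]
  exact isClosed_eq (by fun_prop) (by fun_prop)

theorem lipschitzWith_graphMap {g : E2 → ℝ} {K : NNReal} (hg : LipschitzWith K g) :
    LipschitzWith (1 + K) (graphMap g) := by
  refine LipschitzWith.of_dist_le_mul fun x y => ?_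
  rw [dist_eq_norm, graphMap_sub, dist_eq_norm]
  refine (norm_lift_add_vert_le _ _).trans ?_
  have := hg.dist_le_mul x y
  rw [Real.dist_eq, dist_eq_norm] at this
  push_cast
  linarith

theorem measurePreserving_lift_add_vert :
    MeasurePreserving (fun p : E2 × ℝ => lift p.1 + p.2 • vert) volume volume := by
  have h1 := (volume_preserving_piFinSuccAbove (fun _ : Fin 3 => ℝ) 2).symm
  have h2 : MeasurePreserving (fun p : E2 × ℝ => (p.2, WithLp.ofLp p.1))
      volume volume :=
    Measure.measurePreserving_swap.comp
      ((PiLp.volume_preserving_ofLp (Fin 2)).prod (MeasurePreserving.id volume))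
  have h3 := (PiLp.volume_preserving_toLp (Fin 3)).comp (h1.comp h2)
  convert! h3 using 1
  funext p
  ext i
  fin_cases i <;> simp [lift_eq, vert, MeasurableEquiv.piFinSuccAbove] <;> rfl

/-- A vertical shear translates each vertical line, so it preserves volume by Fubini, with no
derivative of `g` involved. -/
theorem measurePreserving_graphMap_add {g : E2 → ℝ} (hg : Continuous g) :
    MeasurePreserving (fun p : E2 × ℝ => graphMap (fun y => g y + p.2) p.1) volume volume := by
  have h : MeasurePreserving (fun p : E2 × ℝ => (p.1, g p.1 + p.2)) volume volume :=
    (MeasurePreserving.id (volume : Measure E2)).skew_product (g := fun y s => g y + s)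
      (by fun_prop) (ae_of_all _ fun y => map_add_left_eq_self volume (g y))
  exact measurePreserving_lift_add_vert.comp h

/-! ### The area formula for Lipschitz graphs. -/

theorem euclideanHausdorffMeasure_image_le_of_lipschitzOnWith {X Y : Type*} [MetricSpace X]
    [MeasurableSpace X] [BorelSpace X] [MetricSpace Y] [MeasurableSpace Y] [BorelSpace Y]
    {f : X → Y} {s : Set X} {C : NNReal} (h : LipschitzOnWith C f s) (d : ℕ) :
    μHE[d] (f '' s) ≤ (C : ENNReal) ^ d * μHE[d] s := by
  simp only [Measure.euclideanHausdorffMeasure_def, Measure.smul_apply, Measure.nnreal_smul_coe_apply]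
  rw [mul_left_comm]
  gcongr
  simpa using h.hausdorffMeasure_image_le (d := (d : ℝ)) (by positivity)

/-- The linear parametrization of the plane with slope `q`. -/
def slopeMap (q : E2) : E2 →ₗ[ℝ] E3 :=
  lift.toLinearMap + (innerₗ E2 q).smulRight vert

theorem slopeMap_apply (q a : E2) : slopeMap q a = lift a + inner ℝ q a • vert := rfl

/-- The Gram matrix of the images of the basis vectors is `I + q qᵀ`. -/
theorem normDet_slopeMap (q : E2) : (slopeMap q).normDet = √(1 + ‖q‖ ^ 2) := by
  rw [eq_comm, Real.sqrt_eq_iff_mul_self_eq (by positivity) (LinearMap.normDet_nonneg _), ← sq]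
  have := (slopeMap q).normDet_sq_eq_det_gram (EuclideanSpace.basisFun (Fin 2) ℝ)
  simp only [RCLike.ofReal_real_eq_id, id_eq] at this
  rw [this, Matrix.det_fin_two]
  simp only [Matrix.gram_apply, slopeMap_apply, inner_lift_add_vert]
  simp [EuclideanSpace.norm_sq_eq, Fin.sum_univ_two, EuclideanSpace.inner_single_right]
  ring

theorem euclideanHausdorffMeasure_image_slopeMap (q : E2) (s : Set E2) :
    μHE[2] (slopeMap q '' s) = ENNReal.ofReal √(1 + ‖q‖ ^ 2) * volume s := by
  have := (slopeMap q).euclideanHausdorffMeasure_image_eq_normDet_mul_volume s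
  rwa [normDet_slopeMap, finrank_euclideanSpace_fin] at this

section Piece

variable {g : E2 → ℝ} {q : E2} {s : Set E2} {δ : NNReal}

/-- The error is vertical, and `‖x - y‖` is at most the length of the lifted vector. Measuring the
error against that length makes the Lipschitz constants below independent of `q`. -/
theorem norm_graphMap_sub_sub_le
    (h : ∀ x ∈ s, ∀ y ∈ s, |g x - g y - inner ℝ q (x - y)| ≤ δ * ‖x - y‖) {x y : E2}
    (hx : x ∈ s) (hy : y ∈ s) :
    ‖graphMap g x - graphMap g y - slopeMap q (x - y)‖ ≤ δ * ‖slopeMap q (x - y)‖ := by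
  have e : graphMap g x - graphMap g y - slopeMap q (x - y)
      = (g x - g y - inner ℝ q (x - y)) • vert := by
    rw [graphMap_sub, slopeMap_apply, sub_smul _ (inner ℝ q (x - y))]; abel
  rw [e, norm_smul, norm_vert, mul_one, Real.norm_eq_abs]
  exact (h x hx y hy).trans
    (mul_le_mul_of_nonneg_left (norm_le_norm_lift_add_vert _ _) δ.2)

/-- The flat piece of slope `q` maps onto the curved one by `graphMap g ∘ proj`, which is `(1 +
δ)`-Lipschitz there. -/
theorem measure_graph_le
    (h : ∀ x ∈ s, ∀ y ∈ s, |g x - g y - inner ℝ q (x - y)| ≤ δ * ‖x - y‖) :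
    μHE[2] (graphMap g '' s) ≤
      ((1 + δ : NNReal) : ENNReal) ^ 2 * (ENNReal.ofReal √(1 + ‖q‖ ^ 2) * volume s) := by
  have hl : LipschitzOnWith (1 + δ) (graphMap g ∘ proj) (slopeMap q '' s) := by
    refine LipschitzOnWith.of_dist_le_mul ?_
    rintro _ ⟨x, hx, rfl⟩ _ ⟨y, hy, rfl⟩
    have hp : ∀ a, proj (slopeMap q a) = a := fun a => by simp [slopeMap_apply]
    simp only [Function.comp_apply, hp, dist_eq_norm, ← map_sub (slopeMap q)]
    have := norm_graphMap_sub_sub_le h hx hy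
    have h2 := norm_sub_norm_le (graphMap g x - graphMap g y) (slopeMap q (x - y))
    push_cast
    linarith
  have := euclideanHausdorffMeasure_image_le_of_lipschitzOnWith hl 2
  rw [euclideanHausdorffMeasure_image_slopeMap, image_image] at this
  simpa [slopeMap_apply] using this

theorem le_measure_graph (hδ : δ < 1)
    (h : ∀ x ∈ s, ∀ y ∈ s, |g x - g y - inner ℝ q (x - y)| ≤ δ * ‖x - y‖) :
    ENNReal.ofReal √(1 + ‖q‖ ^ 2) * volume s ≤
      (((1 - δ)⁻¹ : NNReal) : ENNReal) ^ 2 * μHE[2] (graphMap g '' s) := by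
  have hl : LipschitzOnWith (1 - δ)⁻¹ (slopeMap q ∘ proj) (graphMap g '' s) := by
    refine LipschitzOnWith.of_dist_le_mul ?_
    rintro _ ⟨x, hx, rfl⟩ _ ⟨y, hy, rfl⟩
    simp only [Function.comp_apply, proj_graphMap, dist_eq_norm, ← map_sub (slopeMap q)]
    have := norm_graphMap_sub_sub_le h hx hy
    have h2 := norm_sub_norm_le (slopeMap q (x - y)) (graphMap g x - graphMap g y)
    rw [norm_sub_rev (slopeMap q (x - y))] at h2
    have h3 : (0 : ℝ) < 1 - δ := by
      have : (δ : ℝ) < 1 := by exact_mod_cast hδ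
      linarith
    rw [NNReal.coe_inv, NNReal.coe_sub hδ.le, NNReal.coe_one, le_inv_mul_iff₀ h3]
    linarith
  have := euclideanHausdorffMeasure_image_le_of_lipschitzOnWith hl 2
  rw [image_image] at this
  simp only [Function.comp_apply, proj_graphMap] at this
  rwa [euclideanHausdorffMeasure_image_slopeMap] at this

end Piece

/-- Triangle inequality for the vectors `(1, p)` and `(1, q)`, the second having length at least 1.
It allows the area density to be treated as nearly constant on a piece where the gradient is close
to `q`. -/
theorem sqrt_one_add_norm_sq_le (p q : E2) :
    √(1 + ‖p‖ ^ 2) ≤ (1 + ‖p - q‖) * √(1 + ‖q‖ ^ 2) := by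
  have h1 : 1 ≤ √(1 + ‖q‖ ^ 2) := Real.one_le_sqrt.2 (by nlinarith [sq_nonneg ‖q‖])
  have h2 : ‖q‖ ≤ √(1 + ‖q‖ ^ 2) := Real.le_sqrt_of_sq_le (by linarith)
  have h3 : ‖p‖ ≤ ‖q‖ + ‖p - q‖ := by simpa using norm_add_le q (p - q)
  have h4 : √(1 + ‖q‖ ^ 2) ^ 2 = 1 + ‖q‖ ^ 2 := Real.sq_sqrt (by positivity)
  rw [Real.sqrt_le_left (by positivity)]
  have h5 : ‖q‖ + ‖p - q‖ ≤ ‖q‖ + ‖p - q‖ * √(1 + ‖q‖ ^ 2) := by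
    nlinarith [norm_nonneg (p - q)]
  have h6 : ‖p‖ ^ 2 ≤ (‖q‖ + ‖p - q‖) ^ 2 := by gcongr
  rw [mul_pow, h4]
  nlinarith [norm_nonneg (p - q), norm_nonneg q, mul_nonneg (norm_nonneg (p - q)) (sq_nonneg (‖q‖ - 1)),
    mul_nonneg (norm_nonneg (p-q)) (norm_nonneg q), sq_nonneg (‖p - q‖ * ‖q‖)]

theorem measurable_gradient (g : E2 → ℝ) : Measurable (gradient g) :=
  (InnerProductSpace.toDual ℝ E2).symm.continuous.measurable.comp (measurable_fderiv ℝ g)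

theorem fderiv_eq_inner_gradient (g : E2 → ℝ) (y a : E2) :
    fderiv ℝ g y a = inner ℝ (gradient g y) a := by
  rw [gradient, InnerProductSpace.toDual_symm_apply]

/-- The surface area density of the graph of `g`. -/
def areaDensity (g : E2 → ℝ) (y : E2) : ℝ := √(1 + ‖gradient g y‖ ^ 2)

theorem measurable_areaDensity (g : E2 → ℝ) : Measurable (areaDensity g) := by
  have := measurable_gradient g
  unfold areaDensity
  fun_prop

theorem areaDensity_pos (g : E2 → ℝ) (y : E2) : 0 < areaDensity g y :=
  Real.sqrt_pos.2 (by positivity)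

/-- Decomposition of the set of differentiability points into pieces on which `g` is almost
affine. -/
theorem exists_partition_slope {g : E2 → ℝ} {s : Set E2} (hs : MeasurableSet s)
    (hd : ∀ x ∈ s, DifferentiableAt ℝ g x) {δ : NNReal} (hδ : δ ≠ 0) :
    ∃ (t : ℕ → Set E2) (q : ℕ → E2), Pairwise (Function.onFun Disjoint t) ∧
      (∀ n, MeasurableSet (t n)) ∧ s = ⋃ n, t n ∧
      (∀ n, ∀ x ∈ t n, ∀ y ∈ t n, |g x - g y - inner ℝ (q n) (x - y)| ≤ δ * ‖x - y‖) ∧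
      ∀ n, ∀ᵐ x ∂volume.restrict (t n), ‖gradient g x - q n‖ ≤ δ := by
  rcases s.eq_empty_or_nonempty with rfl | hne
  · exact ⟨fun _ => ∅, fun _ => 0, fun _ _ _ => disjoint_bot_left, by simp, by simp, by simp, by simp⟩
  -- Multiplying by a unit vector makes `g` a self-map of the plane, the setting of
  -- `ApproximatesLinearOn.norm_fderiv_sub_le`, without changing any norm.
  let e : E2 := EuclideanSpace.single 0 1
  have he : ‖e‖ = 1 := by simp [e]
  let f' : E2 → E2 →L[ℝ] E2 := fun x => (fderiv ℝ g x).smulRight e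
  have hf' : ∀ x ∈ s, HasFDerivWithinAt (fun x => g x • e) (f' x) s x := fun x hx =>
    ((hd x hx).hasFDerivAt.smul_const e).hasFDerivWithinAt
  obtain ⟨t, A, htd, htm, hst, happ, hA⟩ := exists_partition_approximatesLinearOn_of_hasFDerivWithinAt
    (fun x => g x • e) s f' hf' (fun _ => δ) (fun _ => hδ)
  choose z hzs hz using hA hne
  have hsub : ∀ (a : ℝ), ‖a • e‖ = |a| := fun a => by rw [norm_smul, he, mul_one, Real.norm_eq_abs]
  refine ⟨fun n => s ∩ t n, fun n => gradient g (z n), fun i j hij =>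
    (htd hij).mono inter_subset_right inter_subset_right, fun n => hs.inter (htm n), ?_, ?_, ?_⟩
  · rw [← inter_iUnion, inter_eq_left.2 hst]
  · intro n x hx y hy
    have := happ n x hx y hy
    rw [hz n] at this
    simp only [f', ContinuousLinearMap.smulRight_apply, ← sub_smul, hsub] at this
    rwa [fderiv_eq_inner_gradient] at this
  · intro n
    have := (happ n).norm_fderiv_sub_le (μ := volume) (hs.inter (htm n)) f'
      (fun x hx => (hf' x hx.1).mono inter_subset_left)
    filter_upwards [this] with x hx
    rw [gradient, gradient, ← map_sub, LinearIsometryEquiv.norm_map]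
    refine ContinuousLinearMap.opNorm_le_bound _ δ.2 fun a => ?_
    have h1 := (f' x - A n).le_of_opNorm_le hx a
    rw [hz n] at h1
    simp only [f', sub_apply, ContinuousLinearMap.smulRight_apply, ← sub_smul, hsub] at h1
    exact h1

/-- On almost affine pieces, area and integral agree up to the factors `(1 + δ)³` and `(1 + δ)(1 -
δ)⁻²`; summing over the pieces and letting `δ → 0` gives equality. -/
theorem measure_graph_image_of_differentiable {g : E2 → ℝ} (hg : Continuous g) {s : Set E2}
    (hs : MeasurableSet s) (hd : ∀ x ∈ s, DifferentiableAt ℝ g x) :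
    μHE[2] (graphMap g '' s) = ∫⁻ y in s, ENNReal.ofReal (areaDensity g y) := by
  have hemb := (isClosedEmbedding_graphMap hg).measurableEmbedding
  have hdens : ∀ (δ : NNReal) (p q : E2), ‖p - q‖ ≤ δ → ENNReal.ofReal √(1 + ‖p‖ ^ 2) ≤
      ((1 + δ : NNReal) : ENNReal) * ENNReal.ofReal √(1 + ‖q‖ ^ 2) := by
    intro δ p q h
    rw [← ENNReal.ofReal_coe_nnreal, ← ENNReal.ofReal_mul (by positivity)]
    refine ENNReal.ofReal_le_ofReal ((sqrt_one_add_norm_sq_le p q).trans ?_)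
    push_cast
    gcongr
  have key : ∀ δ : NNReal, δ ≠ 0 → δ < 1 →
      μHE[2] (graphMap g '' s) ≤ ((1 + δ : NNReal) : ENNReal) ^ 2 * ((1 + δ : NNReal) : ENNReal) *
        ∫⁻ y in s, ENNReal.ofReal (areaDensity g y) ∧
      ∫⁻ y in s, ENNReal.ofReal (areaDensity g y) ≤
        ((1 + δ : NNReal) : ENNReal) * (((1 - δ)⁻¹ : NNReal) : ENNReal) ^ 2 *
          μHE[2] (graphMap g '' s) := by
    intro δ hδ hδ1
    obtain ⟨t, q, htd, htm, hst, happ, hgrad⟩ := exists_partition_slope hs hd hδ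
    have hint : ∫⁻ y in s, ENNReal.ofReal (areaDensity g y) =
        ∑' n, ∫⁻ y in t n, ENNReal.ofReal (areaDensity g y) := by
      rw [hst, lintegral_iUnion htm htd]
    have hmeas : μHE[2] (graphMap g '' s) = ∑' n, μHE[2] (graphMap g '' t n) := by
      rw [hst, image_iUnion, measure_iUnion (fun i j hij =>
        (disjoint_image_iff (graphMap_injective g)).2 (htd hij))
        (fun n => hemb.measurableSet_image.2 (htm n))]
    rw [hint, hmeas, ← ENNReal.tsum_mul_left, ← ENNReal.tsum_mul_left]
    refine ⟨ENNReal.tsum_le_tsum fun n => ?_, ENNReal.tsum_le_tsum fun n => ?_⟩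
    · refine (measure_graph_le (happ n)).trans ?_
      rw [mul_assoc]
      refine mul_le_mul_right ?_ _
      rw [← setLIntegral_const, ← lintegral_const_mul' _ _ ENNReal.coe_ne_top]
      refine lintegral_mono_ae ?_
      filter_upwards [hgrad n] with x hx
      exact hdens δ _ _ (by rwa [norm_sub_rev])
    · rw [mul_assoc]
      refine le_trans ?_ (mul_le_mul_right (le_measure_graph hδ1 (happ n)) _)
      rw [← setLIntegral_const, ← lintegral_const_mul' _ _ ENNReal.coe_ne_top]
      refine lintegral_mono_ae ?_
      filter_upwards [hgrad n] with x hx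
      exact hdens δ _ _ hx
  have hev : ∀ᶠ δ : NNReal in 𝓝[>] 0, δ ≠ 0 ∧ δ < 1 := by
    filter_upwards [self_mem_nhdsWithin, mem_nhdsWithin_of_mem_nhds (Iio_mem_nhds one_pos)]
      with δ h1 h2 using ⟨(mem_Ioi.1 h1).ne', h2⟩
  have hne : (𝓝[>] (0 : NNReal)).NeBot := inferInstance
  have ht1 : Tendsto (fun δ : NNReal => 1 + δ) (𝓝[>] 0) (𝓝 1) := by
    have : Continuous fun δ : NNReal => 1 + δ := by fun_prop
    simpa using (this.tendsto 0).mono_left nhdsWithin_le_nhds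
  have ht2 : Tendsto (fun δ : NNReal => (1 - δ)⁻¹) (𝓝[>] 0) (𝓝 1) := by
    have : ContinuousAt (fun δ : NNReal => (1 - δ)⁻¹) 0 :=
      ContinuousAt.inv₀ (by fun_prop) (by simp)
    simpa using this.tendsto.mono_left nhdsWithin_le_nhds
  apply le_antisymm
  · have ht : Tendsto (fun δ : NNReal =>
        ((1 + δ : NNReal) : ENNReal) ^ 2 * ((1 + δ : NNReal) : ENNReal) *
        ∫⁻ y in s, ENNReal.ofReal (areaDensity g y)) (𝓝[>] 0)
        (𝓝 (1 * ∫⁻ y in s, ENNReal.ofReal (areaDensity g y))) := by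
      -- The factor tends to `1 ≠ 0`, so the limit is valid even if the integral is infinite.
      refine ENNReal.Tendsto.mul_const ?_ (Or.inl one_ne_zero)
      have := ENNReal.tendsto_coe.2 ((ht1.pow 2).mul ht1)
      simpa using this
    rw [one_mul] at ht
    exact ge_of_tendsto ht (hev.mono fun δ h => (key δ h.1 h.2).1)
  · have ht : Tendsto (fun δ : NNReal =>
        ((1 + δ : NNReal) : ENNReal) * (((1 - δ)⁻¹ : NNReal) : ENNReal) ^ 2 *
          μHE[2] (graphMap g '' s)) (𝓝[>] 0) (𝓝 (1 * μHE[2] (graphMap g '' s))) := by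
      refine ENNReal.Tendsto.mul_const ?_ (Or.inl one_ne_zero)
      have := ENNReal.tendsto_coe.2 (ht1.mul (ht2.pow 2))
      simpa only [ENNReal.coe_mul, ENNReal.coe_pow, one_pow, mul_one, ENNReal.coe_one] using this
    rw [one_mul] at ht
    exact ge_of_tendsto ht (hev.mono fun δ h => (key δ h.1 h.2).2)

/-- The area formula for the graph of a Lipschitz function. -/
theorem measure_graph_image {g : E2 → ℝ} {K : NNReal} (hg : LipschitzWith K g) {s : Set E2}
    (hs : MeasurableSet s) :
    μHE[2] (graphMap g '' s) = ∫⁻ y in s, ENNReal.ofReal (areaDensity g y) := by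
  set d : Set E2 := {y | DifferentiableAt ℝ g y}
  have hdm : MeasurableSet d := measurableSet_of_differentiableAt ℝ g
  have hdn : volume dᶜ = 0 := hg.ae_differentiableAt
  -- By Rademacher the non-differentiability set is null, and a Lipschitz map sends it to a set of
  -- zero area.
  have hnull : μHE[2] (graphMap g '' (s \ d)) = 0 := by
    have h1 := euclideanHausdorffMeasure_image_le_of_lipschitzOnWith
      ((lipschitzWith_graphMap hg).lipschitzOnWith (s := dᶜ)) 2
    rw [EuclideanSpace.euclideanHausdorffMeasure_eq_volume, hdn, mul_zero] at h1
    exact measure_mono_null (image_mono (fun x hx => hx.2)) (le_antisymm h1 bot_le)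
  have h2 : μHE[2] (graphMap g '' s) = μHE[2] (graphMap g '' (s ∩ d)) := by
    refine le_antisymm ?_ (measure_mono (image_mono inter_subset_left))
    conv_lhs => rw [← inter_union_sdiff s d, image_union]
    refine (measure_union_le _ _).trans ?_
    rw [hnull, add_zero]
  rw [h2, measure_graph_image_of_differentiable hg.continuous (hs.inter hdm) fun x hx => hx.2]
  refine setLIntegral_congr ?_
  exact inter_ae_eq_left_of_ae_eq_univ (ae_eq_univ.2 hdn)

theorem restrict_range_graphMap {g : E2 → ℝ} {K : NNReal} (hg : LipschitzWith K g) :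
    (μHE[2] : Measure E3).restrict (range (graphMap g)) =
      (volume.withDensity fun y => ENNReal.ofReal (areaDensity g y)).map (graphMap g) := by
  have hemb := (isClosedEmbedding_graphMap hg.continuous).measurableEmbedding
  ext s hs
  rw [Measure.restrict_apply hs, hemb.map_apply, withDensity_apply _ (hemb.measurable hs),
    ← measure_graph_image hg (hemb.measurable hs), image_preimage_eq_inter_range]

/-! ### The divergence theorem below a Lipschitz graph. -/

/-- The density of the flux of the constant field `v` through the graph of `g`. -/
def fluxDensity (g : E2 → ℝ) (v : E3) (y : E2) : ℝ := v 2 - inner ℝ (gradient g y) (proj v)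

theorem measurable_fluxDensity (g : E2 → ℝ) (v : E3) : Measurable (fluxDensity g v) := by
  have := measurable_gradient g
  unfold fluxDensity
  fun_prop

theorem norm_gradient_le {g : E2 → ℝ} {K : NNReal} (hg : LipschitzWith K g) (y : E2) :
    ‖gradient g y‖ ≤ K := by
  rw [gradient, LinearIsometryEquiv.norm_map]
  exact norm_fderiv_le_of_lipschitz ℝ hg

theorem norm_fluxDensity_le {g : E2 → ℝ} {K : NNReal} (hg : LipschitzWith K g) (v : E3) (y : E2) :
    ‖fluxDensity g v y‖ ≤ |v 2| + K * ‖proj v‖ := by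
  refine (norm_sub_le _ _).trans ?_
  rw [Real.norm_eq_abs]
  gcongr
  exact (norm_inner_le_norm _ _).trans (by gcongr; exact norm_gradient_le hg y)

theorem gradient_add_const (g : E2 → ℝ) (c : ℝ) (y : E2) :
    gradient (fun y => g y + c) y = gradient g y := by
  simp [gradient, fderiv_add_const]

/-- Integration by parts against the constant function 1. -/
theorem integral_lineDeriv_eq_zero {E : Type*} [NormedAddCommGroup E] [NormedSpace ℝ E]
    [FiniteDimensional ℝ E] [MeasurableSpace E] [BorelSpace E] {μ : Measure E}
    [μ.IsAddHaarMeasure] {f : E → ℝ} {C : NNReal} (hf : LipschitzWith C f)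
    (hc : HasCompactSupport f) (v : E) : ∫ x, lineDeriv ℝ f x v ∂μ = 0 := by
  have h := LipschitzWith.integral_lineDeriv_mul_eq (μ := μ)
    (LipschitzWith.const (α := E) (1 : ℝ)) hf hc (-v)
  have h0 : ∀ x : E, lineDeriv ℝ (fun _ : E => (1 : ℝ)) x (-v) = 0 := fun x => by simp [lineDeriv]
  simpa [h0] using h.symm

/-- Along the graph of a Lipschitz function, the derivatives of a test function in all
directions are determined, in the mean, by its vertical derivative. -/
theorem integral_fderiv_graphMap {g : E2 → ℝ} {K : NNReal} (hg : LipschitzWith K g)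
    {G : E3 → ℝ} (hG : ContDiff ℝ 1 G) (hc : HasCompactSupport G) (v : E3) :
    ∫ y, fderiv ℝ G (graphMap g y) v =
      ∫ y, fluxDensity g v y * fderiv ℝ G (graphMap g y) vert := by
  have hemb := isClosedEmbedding_graphMap hg.continuous
  obtain ⟨C, hC⟩ := hG.lipschitzWith_of_hasCompactSupport hc one_ne_zero
  have hz := integral_lineDeriv_eq_zero (μ := volume) (hC.comp (lipschitzWith_graphMap hg))
    (hc.comp_isClosedEmbedding hemb) (proj v)
  have hint : ∀ w : E3, Integrable fun y => fderiv ℝ G (graphMap g y) w := fun w => by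
    refine Continuous.integrable_of_hasCompactSupport
      (f := fun y => fderiv ℝ G (graphMap g y) w)
      (((hG.continuous_fderiv one_ne_zero).comp hemb.continuous).clm_apply continuous_const) ?_
    exact ((hc.fderiv_apply (𝕜 := ℝ) w).comp_isClosedEmbedding hemb)
  -- The tangent vector of the graph above `proj v` is `v - fluxDensity g v y • vert`; this is the
  -- chain rule at points where `g` is differentiable.
  have hae : ∀ᵐ y, lineDeriv ℝ (G ∘ graphMap g) y (proj v) =
      fderiv ℝ G (graphMap g y) v - fluxDensity g v y * fderiv ℝ G (graphMap g y) vert := by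
    filter_upwards [hg.ae_differentiableAt (μ := volume)] with y hy
    have h1 : HasFDerivAt (graphMap g) (lift + (fderiv ℝ g y).smulRight vert) y :=
      lift.hasFDerivAt.add (hy.hasFDerivAt.smul_const vert)
    have h2 := ((hG.differentiable one_ne_zero).differentiableAt.hasFDerivAt.comp y h1)
    rw [h2.differentiableAt.lineDeriv_eq_fderiv, h2.fderiv]
    have h3 : lift (proj v) = v - v 2 • vert := by
      conv_rhs => rw [← lift_proj_add v]
      simp
    simp only [ContinuousLinearMap.comp_apply, add_apply,
      ContinuousLinearMap.smulRight_apply, h3, map_add, map_sub, map_smul, fluxDensity,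
      fderiv_eq_inner_gradient, smul_eq_mul]
    ring
  rw [integral_congr_ae hae, integral_sub (hint v)] at hz
  · linarith
  · exact (hint vert).bdd_mul (measurable_fluxDensity g v).aestronglyMeasurable
      (ae_of_all _ (norm_fluxDensity_le hg v))

/-- The open region below the graph of `g`. -/
def below (g : E2 → ℝ) : Set E3 := {z | z 2 < g (proj z)}

theorem isOpen_below {g : E2 → ℝ} (hg : Continuous g) : IsOpen (below g) :=
  isOpen_lt (by fun_prop) (by fun_prop)

/-- A cutoff equal to 1 near the points below the graph of `g + s`, and to 0 near the complement of
`below g`, makes `G` globally C¹ without changing it near the slice. This is where `s < 0` is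
needed. -/
theorem integral_fderiv_graphMap_of_contDiffOn_below {g : E2 → ℝ} {K : NNReal}
    (hg : LipschitzWith K g) {G : E3 → ℝ} (hG : ContDiffOn ℝ 1 G (below g))
    (hc : HasCompactSupport G) (v : E3) {s : ℝ} (hs : s < 0) :
    ∫ y, fderiv ℝ G (graphMap (fun y => g y + s) y) v =
      ∫ y, fluxDensity g v y * fderiv ℝ G (graphMap (fun y => g y + s) y) vert := by
  have hgc := hg.continuous
  have hcl : IsClosed {z : E3 | z 2 ≤ g (proj z) + s} := isClosed_le (by fun_prop) (by fun_prop)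
  obtain ⟨χ, h0, h1, -⟩ := exists_contMDiffMap_zero_one_nhds_of_isClosed 𝓘(ℝ, E3) (n := 1)
    (isOpen_below hgc).isClosed_compl hcl (by
      rw [← subset_compl_iff_disjoint_left, compl_compl]
      intro z hz
      simp only [mem_ofPred_eq, below] at hz ⊢
      linarith)
  have hχ : ContDiff ℝ 1 χ := by simpa using χ.contMDiff.contDiff
  have hprod : ContDiff ℝ 1 (fun z => χ z * G z) := by
    rw [contDiff_iff_contDiffAt]
    intro z
    by_cases hz : z ∈ below g
    · exact hχ.contDiffAt.mul (hG.contDiffAt ((isOpen_below hgc).mem_nhds hz))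
    · have : (fun z => χ z * G z) =ᶠ[𝓝 z] fun _ => 0 := by
        filter_upwards [h0.filter_mono (nhds_le_nhdsSet hz)] with x hx
        simp [hx]
      exact contDiffAt_const.congr_of_eventuallyEq this
  have hfd : ∀ y, fderiv ℝ (fun z => χ z * G z) (graphMap (fun y => g y + s) y) =
      fderiv ℝ G (graphMap (fun y => g y + s) y) := fun y => by
    refine Filter.EventuallyEq.fderiv_eq ?_
    have hmem : graphMap (fun y => g y + s) y ∈ {z : E3 | z 2 ≤ g (proj z) + s} := by simp
    filter_upwards [h1.filter_mono (nhds_le_nhdsSet hmem)] with x hx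
    simp [hx]
  have hlip : LipschitzWith K fun y => g y + s := by
    simpa using hg.add (LipschitzWith.const s)
  have := integral_fderiv_graphMap hlip hprod (hc.mul_left (f := χ)) v
  simpa only [hfd, fluxDensity, gradient_add_const] using this

theorem measurableEmbedding_graphMap_add {g : E2 → ℝ} (hg : Continuous g) :
    MeasurableEmbedding (fun p : E2 × ℝ => graphMap (fun y => g y + p.2) p.1) := by
  refine (measurePreserving_graphMap_add hg).measurable.measurableEmbedding ?_
  rintro ⟨y, s⟩ ⟨y', s'⟩ h
  have h1 := congrArg proj h
  have h2 := congrArg (fun z : E3 => z 2) h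
  simp only [proj_graphMap, graphMap_apply_two] at h1 h2
  subst h1
  simpa using h2

theorem isometry_graphMap_add (g : E2 → ℝ) (y : E2) :
    Isometry fun s : ℝ => graphMap (fun y => g y + s) y := by
  refine Isometry.of_dist_eq fun s t => ?_
  simp [dist_eq_norm, graphMap, ← sub_smul, norm_smul]

/-- The divergence theorem below the graph of a Lipschitz function. -/
theorem integral_below_fderiv {g : E2 → ℝ} {K : NNReal}
    (hg : LipschitzWith K g) {G : E3 → ℝ} (hG : ContDiffOn ℝ 1 G (below g))
    (hGc : ContinuousOn G {z | z 2 ≤ g (proj z)})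
    (hc : HasCompactSupport G) {C : ℝ} (hC : ∀ z ∈ below g, ‖fderiv ℝ G z‖ ≤ C) (v : E3) :
    ∫ z in below g, fderiv ℝ G z v = ∫ y, fluxDensity g v y * G (graphMap g y) := by
  have hgc := hg.continuous
  set T : E2 × ℝ → E3 := fun p => graphMap (fun y => g y + p.2) p.1 with hT
  have hTm : MeasurePreserving T volume volume := measurePreserving_graphMap_add hgc
  have hTe : MeasurableEmbedding T := measurableEmbedding_graphMap_add hgc
  have hpre : T ⁻¹' below g = univ ×ˢ Iio 0 := by
    ext ⟨y, s⟩; simp [T, below]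
  have hmeas : (volume : Measure (E2 × ℝ)).restrict (T ⁻¹' below g) =
      (volume : Measure E2).prod ((volume : Measure ℝ).restrict (Iio 0)) := by
    rw [hpre, Measure.volume_eq_prod, ← Measure.prod_restrict, Measure.restrict_univ]
  have hint : ∀ w : E3, Integrable (fun p => fderiv ℝ G (T p) w)
      ((volume : Measure E2).prod ((volume : Measure ℝ).restrict (Iio 0))) := by
    intro w
    rw [← hmeas]
    refine (hTm.integrableOn_comp_preimage hTe (f := fun z => fderiv ℝ G z w)).2 ?_
    have hsupp : Function.support (fun z => fderiv ℝ G z w) ⊆ tsupport G := fun z hz =>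
      support_fderiv_subset ℝ (fun h => hz (by simp [h]))
    refine (integrableOn_iff_integrable_of_support_subset hsupp).1 ?_
    refine Measure.integrableOn_of_bounded (M := C * ‖w‖) ?_
      (measurable_fderiv_apply_const ℝ G w).aestronglyMeasurable ?_
    · exact ((Measure.restrict_apply_le _ _).trans_lt hc.isCompact.measure_lt_top).ne
    · refine ae_restrict_of_ae ?_
      filter_upwards [ae_restrict_mem (isOpen_below hgc).measurableSet] with z hz
      exact (ContinuousLinearMap.le_opNorm _ _).trans (by gcongr; exact hC z hz)
  have hint2 : Integrable (fun p : E2 × ℝ => fluxDensity g v p.1 * fderiv ℝ G (T p) vert)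
      ((volume : Measure E2).prod ((volume : Measure ℝ).restrict (Iio 0))) :=
    (hint vert).bdd_mul ((measurable_fluxDensity g v).comp measurable_fst).aestronglyMeasurable
      (ae_of_all _ fun p => norm_fluxDensity_le hg v p.1)
  rw [← hTm.setIntegral_preimage_emb hTe, hmeas, integral_prod_symm _ (hint v)]
  have hslice : ∫ s in Iio 0, ∫ y, fderiv ℝ G (T (y, s)) v =
      ∫ s in Iio 0, ∫ y, fluxDensity g v y * fderiv ℝ G (T (y, s)) vert :=
    setIntegral_congr_fun measurableSet_Iio fun s hs =>
      integral_fderiv_graphMap_of_contDiffOn_below hg hG hc v hs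
  rw [hslice, ← integral_prod_symm _ hint2, integral_prod _ hint2]
  refine integral_congr_ae ?_
  filter_upwards [(hint vert).prod_right_ae] with y hy
  rw [integral_const_mul]
  congr 1
  -- The fundamental theorem of calculus on each vertical half-line: the value at `-∞` is 0 by
  -- compact support, and at `s = 0` continuity from below suffices.
  rw [← integral_Iic_eq_integral_Iio, integral_Iic_of_hasDerivAt_of_tendsto
    (f := fun s => G (T (y, s))) (m := 0)]
  · simp [T]
  · refine ContinuousWithinAt.comp (t := {z | z 2 ≤ g (proj z)}) (hGc _ (by simp [T])) ?_ ?_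
    · exact (isometry_graphMap_add g y).continuous.continuousWithinAt
    · intro s hs
      simpa [T] using hs
  · intro s hs
    have hmem : T (y, s) ∈ below g := by
      have : (y, s) ∈ T ⁻¹' below g := by rw [hpre]; exact ⟨mem_univ _, hs⟩
      exact this
    have h1 : HasDerivAt (fun s => T (y, s)) vert s := by
      have := (((hasDerivAt_id s).const_add (g y)).smul_const vert).const_add (lift y)
      simpa [T, graphMap] using this
    exact ((hG.contDiffAt ((isOpen_below hgc).mem_nhds hmem)).differentiableAt
      one_ne_zero).hasFDerivAt.comp_hasDerivAt s h1
  · rw [integrableOn_Iic_iff_integrableOn_Iio]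
    exact hy
  · have hcs := hc.comp_isClosedEmbedding (isometry_graphMap_add g y).isClosedEmbedding
    rw [hasCompactSupport_iff_eventuallyEq, Filter.coclosedCompact_eq_cocompact] at hcs
    exact (hcs.filter_mono _root_.atBot_le_cocompact).tendsto

/-! ### Boundary charts, surface measure and the outward normal. -/

/-- In the open set `W`, the set `Q` lies strictly below the graph of the Lipschitz function `g`,
in the orthonormal coordinates `R`. -/
structure IsGraphChart (Q W : Set E3) (R : E3 ≃ₗᵢ[ℝ] E3) (K : NNReal) (g : E2 → ℝ) : Prop where
  isOpen : IsOpen W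
  lipschitz : LipschitzWith K g
  mem_iff : ∀ y ∈ W, y ∈ Q ↔ R y 2 < g (proj (R y))

theorem HasLipschitzBoundary.exists_isGraphChart {Q : Set E3} (hQ : HasLipschitzBoundary Q) {x : E3}
    (hx : x ∈ frontier Q) : ∃ W R K g, x ∈ W ∧ IsGraphChart Q W R K g := by
  obtain ⟨R, K, g, hg, h⟩ := hQ x hx
  obtain ⟨W, hW, hWo, hxW⟩ := _root_.eventually_nhds_iff.1 h
  exact ⟨W, R, K, g, hxW, hWo, hg, hW⟩

theorem continuous_vertical_path (R : E3 ≃ₗᵢ[ℝ] E3) (x : E3) :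
    Continuous fun t : ℝ => x - t • R.symm vert := by fun_prop

/-- The parametrization of a graph in the orthonormal coordinates `R`. -/
def chartMap (R : E3 ≃ₗᵢ[ℝ] E3) (g : E2 → ℝ) (y : E2) : E3 := R.symm (graphMap g y)

/-- The upward unit normal of a graph in the orthonormal coordinates `R`. -/
def graphNormal (R : E3 ≃ₗᵢ[ℝ] E3) (g : E2 → ℝ) (y : E2) : E3 :=
  R.symm ((areaDensity g y)⁻¹ • (vert - lift (gradient g y)))

theorem measurable_graphNormal (R : E3 ≃ₗᵢ[ℝ] E3) (g : E2 → ℝ) :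
    Measurable (graphNormal R g) := by
  have h1 := measurable_gradient g
  have h2 := measurable_areaDensity g
  have h3 : Measurable fun y => lift (gradient g y) := lift.continuous.measurable.comp h1
  exact R.symm.continuous.measurable.comp (h2.inv.smul (measurable_const.sub h3))

/-- The factor `(areaDensity g y)⁻¹` cancels the surface density, so flux through the graph becomes
a plane integral of `fluxDensity`. -/
theorem inner_graphNormal (R : E3 ≃ₗᵢ[ℝ] E3) (g : E2 → ℝ) (y : E2) (v : E3) :
    inner ℝ v (graphNormal R g y) = (areaDensity g y)⁻¹ * fluxDensity g (R v) y := by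
  have h : (vert - lift (gradient g y)) = lift (-gradient g y) + (1 : ℝ) • vert := by
    simp only [map_neg, one_smul]; abel
  rw [graphNormal, ← R.inner_map_map, R.apply_symm_apply, inner_smul_right, h]
  conv_lhs => rw [← lift_proj_add (R v)]
  rw [inner_lift_add_vert, fluxDensity, inner_neg_right, real_inner_comm]
  ring

theorem norm_graphNormal (R : E3 ≃ₗᵢ[ℝ] E3) (g : E2 → ℝ) (y : E2) : ‖graphNormal R g y‖ = 1 := by
  have h : (vert - lift (gradient g y)) = lift (-gradient g y) + (1 : ℝ) • vert := by
    simp only [map_neg, one_smul]; abel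
  have h2 : ‖vert - lift (gradient g y)‖ = areaDensity g y := by
    rw [areaDensity, eq_comm, Real.sqrt_eq_iff_mul_self_eq (by positivity) (norm_nonneg _), ← sq, h,
      norm_sq_lift_add_vert, norm_neg]
    ring
  have := areaDensity_pos g y
  rw [graphNormal, LinearIsometryEquiv.norm_map, norm_smul, h2, Real.norm_eq_abs, abs_inv,
    abs_of_pos this, inv_mul_cancel₀ this.ne']

theorem isClosedEmbedding_chartMap (R : E3 ≃ₗᵢ[ℝ] E3) {g : E2 → ℝ} (hg : Continuous g) :
    IsClosedEmbedding (chartMap R g) :=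
  R.symm.toHomeomorph.isClosedEmbedding.comp (isClosedEmbedding_graphMap hg)

theorem mem_range_chartMap {R : E3 ≃ₗᵢ[ℝ] E3} {g : E2 → ℝ} {x : E3} :
    x ∈ range (chartMap R g) ↔ R x 2 = g (proj (R x)) := by
  rw [← mem_range_graphMap]
  constructor
  · rintro ⟨y, rfl⟩; exact ⟨y, by simp [chartMap]⟩
  · rintro ⟨y, hy⟩; exact ⟨y, by simp [chartMap, hy]⟩

theorem restrict_range_chartMap (R : E3 ≃ₗᵢ[ℝ] E3) {g : E2 → ℝ} {K : NNReal}
    (hg : LipschitzWith K g) :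
    (μHE[2] : Measure E3).restrict (range (chartMap R g)) =
      (volume.withDensity fun y => ENNReal.ofReal (areaDensity g y)).map (chartMap R g) := by
  have hR := R.symm.toIsometryEquiv.measurePreserving_euclideanHausdorffMeasure 2
  have hm := (isClosedEmbedding_graphMap hg.continuous).measurableEmbedding
  have h1 : (volume.withDensity fun y => ENNReal.ofReal (areaDensity g y)).map (chartMap R g) =
      ((volume.withDensity fun y => ENNReal.ofReal (areaDensity g y)).map (graphMap g)).map
        R.symm.toIsometryEquiv := by
    rw [Measure.map_map hR.measurable hm.measurable]; rfl
  have h2 : range (graphMap g) = R.symm.toIsometryEquiv ⁻¹' range (chartMap R g) := by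
    ext z
    simp only [mem_preimage, LinearIsometryEquiv.coe_toIsometryEquiv, mem_range_chartMap,
      LinearIsometryEquiv.apply_symm_apply, mem_range_graphMap]
  rw [h1, ← restrict_range_graphMap hg, h2, ← Measure.restrict_map hR.measurable
    (isClosedEmbedding_chartMap R hg.continuous).isClosed_range.measurableSet, hR.map_eq]

theorem setIntegral_range_chartMap (R : E3 ≃ₗᵢ[ℝ] E3) {g : E2 → ℝ} {K : NNReal}
    (hg : LipschitzWith K g) (H : E3 → ℝ) :
    ∫ x in range (chartMap R g), H x ∂μHE[2] = ∫ y, areaDensity g y * H (chartMap R g y) := by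
  have hm := (isClosedEmbedding_chartMap R hg.continuous).measurableEmbedding
  rw [restrict_range_chartMap R hg, hm.integral_map,
    integral_withDensity_eq_integral_toReal_smul (measurable_areaDensity g).ennreal_ofReal
      (ae_of_all _ fun y => ENNReal.ofReal_lt_top)]
  simp only [smul_eq_mul, ENNReal.toReal_ofReal (areaDensity_pos g _).le]

theorem ae_restrict_range_chartMap (R : E3 ≃ₗᵢ[ℝ] E3) {g : E2 → ℝ} {K : NNReal}
    (hg : LipschitzWith K g) :
    ∀ᵐ x ∂(μHE[2] : Measure E3).restrict (range (chartMap R g)),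
      x ∈ range (chartMap R g) ∧ DifferentiableAt ℝ g (proj (R x)) := by
  have hm := (isClosedEmbedding_chartMap R hg.continuous).measurableEmbedding
  refine (ae_restrict_mem hm.measurableSet_range).and ?_
  rw [restrict_range_chartMap R hg, hm.ae_map_iff]
  refine (withDensity_absolutelyContinuous _ _).ae_le ?_
  filter_upwards [hg.ae_differentiableAt (μ := volume)] with y hy
  simpa [chartMap] using hy

theorem IsOuterUnitNormal.outerNormal_eq {Q : Set E3} {x ν : E3} (h : IsOuterUnitNormal Q x ν) :
    outerNormal Q x = ν := by
  have hex : ∃ ν, IsOuterUnitNormal Q x ν := ⟨ν, h⟩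
  rw [outerNormal, dif_pos hex]
  exact hex.choose_spec.unique h

theorem norm_outerNormal_le (Q : Set E3) (x : E3) : ‖outerNormal Q x‖ ≤ 1 := by
  rw [outerNormal]
  split_ifs with h
  · exact h.choose_spec.1.le
  · simp

namespace IsGraphChart

variable {Q W : Set E3} {R : E3 ≃ₗᵢ[ℝ] E3} {K : NNReal} {g : E2 → ℝ}

theorem mem_closure_iff (h : IsGraphChart Q W R K g) {x : E3} (hx : x ∈ W) :
    x ∈ closure Q ↔ R x 2 ≤ g (proj (R x)) := by
  have hgc := h.lipschitz.continuous
  constructor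
  · intro hcl
    by_contra! hlt
    have ho : IsOpen {y : E3 | g (proj (R y)) < R y 2} := isOpen_lt (by fun_prop) (by fun_prop)
    obtain ⟨y, ⟨hyW, hy⟩, hyQ⟩ := mem_closure_iff_nhds.1 hcl _
      (inter_mem (h.isOpen.mem_nhds hx) (ho.mem_nhds hlt))
    exact lt_asymm hy ((h.mem_iff y hyW).1 hyQ)
  · intro hle
    have ht : Tendsto (fun t : ℝ => x - t • R.symm vert) (𝓝[>] 0) (𝓝 x) := by
      simpa using ((continuous_vertical_path R x).tendsto 0).mono_left nhdsWithin_le_nhds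
    refine mem_closure_of_tendsto ht ?_
    filter_upwards [ht.eventually (h.isOpen.mem_nhds hx), self_mem_nhdsWithin] with t htW ht0
    rw [h.mem_iff _ htW]
    have : (0 : ℝ) < t := ht0
    simp
    linarith

theorem mem_frontier_iff (h : IsGraphChart Q W R K g) (hQ : IsOpen Q) {x : E3} (hx : x ∈ W) :
    x ∈ frontier Q ↔ x ∈ range (chartMap R g) := by
  rw [hQ.frontier_eq, Set.mem_sdiff, h.mem_closure_iff hx, h.mem_iff x hx, mem_range_chartMap, not_lt]
  exact ⟨fun h => le_antisymm h.1 h.2, fun h => ⟨h.le, h.ge⟩⟩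

theorem isOuterUnitNormal (h : IsGraphChart Q W R K g) {y : E2} (hy : DifferentiableAt ℝ g y)
    (hyW : chartMap R g y ∈ W) : IsOuterUnitNormal Q (chartMap R g y) (graphNormal R g y) := by
  refine ⟨norm_graphNormal R g y, fun ε hε => ?_⟩
  have hJ := areaDensity_pos g y
  -- The tolerance is `areaDensity g y * ε` because the normal component is the vertical excess over
  -- the tangent plane divided by `areaDensity g y`.
  have hlo := (hasFDerivAt_iff_isLittleO.1 hy.hasFDerivAt).def (mul_pos hJ hε)
  have hc : Tendsto (fun z : E3 => proj (R z)) (𝓝 (chartMap R g y)) (𝓝 y) := by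
    have : Continuous fun z : E3 => proj (R z) := by fun_prop
    simpa [chartMap] using this.tendsto (chartMap R g y)
  filter_upwards [hc.eventually hlo, h.isOpen.mem_nhds hyW] with z hz hzW
  rw [fderiv_eq_inner_gradient, Real.norm_eq_abs] at hz
  have hR : R (z - chartMap R g y) = R z - graphMap g y := by simp [chartMap]
  have hnorm : ‖proj (R z) - y‖ ≤ ‖z - chartMap R g y‖ := by
    rw [← R.norm_map, hR]
    simpa using norm_proj_le (R z - graphMap g y)
  have hz2 := hz.trans (mul_le_mul_of_nonneg_left hnorm (by positivity))
  rw [h.mem_iff z hzW, inner_graphNormal, hR, fluxDensity]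
  simp only [map_sub, proj_graphMap, PiLp.sub_apply, graphMap_apply_two]
  rw [abs_le] at hz2
  constructor
  · intro h1
    rw [inv_mul_eq_div, lt_div_iff₀ hJ] at h1
    rw [not_lt]
    linarith
  · intro h1
    rw [inv_mul_eq_div, div_lt_iff₀ hJ] at h1
    linarith

theorem ae_outerNormal_eq (h : IsGraphChart Q W R K g) :
    ∀ᵐ x ∂(μHE[2] : Measure E3).restrict (range (chartMap R g)),
      x ∈ W → outerNormal Q x = graphNormal R g (proj (R x)) := by
  filter_upwards [ae_restrict_range_chartMap R h.lipschitz]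
  rintro _ ⟨⟨y, rfl⟩, hd⟩ hxW
  have : proj (R (chartMap R g y)) = y := by simp [chartMap]
  rw [this] at hd ⊢
  exact (h.isOuterUnitNormal hd hxW).outerNormal_eq

/-- Inside `W` the boundary is the graph, and outside `W` the integrand vanishes, so the boundary
may be exchanged for the whole graph. -/
theorem setIntegral_frontier (h : IsGraphChart Q W R K g) (hQ : IsOpen Q) {G : E3 → ℝ}
    (hG : ∀ x ∉ W, G x = 0) (v : E3) :
    ∫ x in frontier Q, G x * inner ℝ v (outerNormal Q x) ∂μHE[2] =
      ∫ y, fluxDensity g (R v) y * G (chartMap R g y) := by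
  have hmr := (isClosedEmbedding_chartMap R h.lipschitz.continuous).isClosed_range.measurableSet
  have h1 : ∫ x in frontier Q, G x * inner ℝ v (outerNormal Q x) ∂μHE[2] =
      ∫ x in range (chartMap R g), G x * inner ℝ v (outerNormal Q x) ∂μHE[2] := by
    rw [← integral_indicator isClosed_frontier.measurableSet, ← integral_indicator hmr]
    congr 1
    funext x
    by_cases hx : x ∈ W
    · by_cases hf : x ∈ frontier Q
      · rw [indicator_of_mem hf, indicator_of_mem ((h.mem_frontier_iff hQ hx).1 hf)]
      · rw [indicator_of_notMem hf, indicator_of_notMem (mt (h.mem_frontier_iff hQ hx).2 hf)]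
    · simp [indicator, hG x hx]
  have h2 : ∫ x in range (chartMap R g), G x * inner ℝ v (outerNormal Q x) ∂μHE[2] =
      ∫ x in range (chartMap R g), G x * inner ℝ v (graphNormal R g (proj (R x))) ∂μHE[2] := by
    refine integral_congr_ae ?_
    filter_upwards [h.ae_outerNormal_eq] with x hx
    by_cases hxW : x ∈ W
    · rw [hx hxW]
    · rw [hG x hxW, zero_mul, zero_mul]
  rw [h1, h2, setIntegral_range_chartMap R h.lipschitz]
  refine integral_congr_ae (ae_of_all _ fun y => ?_)
  have : proj (R (chartMap R g y)) = y := by simp [chartMap]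
  have hJ := (areaDensity_pos g y).ne'
  simp only [this, inner_graphNormal]
  field_simp

/-- Near `x` the boundary lies in a Lipschitz image of a disc, hence has finite area, and the normal
is bounded by 1. As `outerNormal` is defined by choice, its measurability comes from its almost
everywhere equality with `graphNormal`. -/
theorem integrableAtFilter_outerNormal (h : IsGraphChart Q W R K g) (hQ : IsOpen Q) {x : E3}
    (hx : x ∈ W) : IntegrableAtFilter (outerNormal Q) (𝓝[frontier Q] x) μHE[2] := by
  obtain ⟨r, hr, hrW⟩ := Metric.mem_nhds_iff.1 (h.isOpen.mem_nhds hx)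
  refine ⟨frontier Q ∩ ball x r, inter_mem self_mem_nhdsWithin
    (mem_nhdsWithin_of_mem_nhds (ball_mem_nhds x hr)), ?_⟩
  have hsub : frontier Q ∩ ball x r ⊆ range (chartMap R g) := fun z hz =>
    (h.mem_frontier_iff hQ (hrW hz.2)).1 hz.1
  have hms : MeasurableSet (frontier Q ∩ ball x r) :=
    isClosed_frontier.measurableSet.inter measurableSet_ball
  have hfin : μHE[2] (frontier Q ∩ ball x r) < ⊤ := by
    have hsub2 : frontier Q ∩ ball x r ⊆ chartMap R g '' ball (proj (R x)) r := by
      intro z hz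
      obtain ⟨y, rfl⟩ := hsub hz
      refine ⟨y, ?_, rfl⟩
      have h1 : dist (chartMap R g y) x < r := hz.2
      rw [mem_ball, dist_eq_norm] at *
      refine lt_of_le_of_lt ?_ h1
      rw [← R.norm_map]
      simpa [chartMap] using norm_proj_le (R (chartMap R g y - x))
    have hl : LipschitzWith (1 * (1 + K)) (chartMap R g) :=
      R.symm.lipschitz.comp (lipschitzWith_graphMap h.lipschitz)
    refine (measure_mono hsub2).trans_lt
      ((euclideanHausdorffMeasure_image_le_of_lipschitzOnWith hl.lipschitzOnWith 2).trans_lt ?_)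
    rw [EuclideanSpace.euclideanHausdorffMeasure_eq_volume]
    exact ENNReal.mul_lt_top (by simp [ENNReal.pow_lt_top_iff, -ENNReal.coe_mul, -ENNReal.coe_add])
      measure_ball_lt_top
  have hfm : IsFiniteMeasure ((μHE[2] : Measure E3).restrict (frontier Q ∩ ball x r)) :=
    ⟨by rwa [Measure.restrict_apply_univ]⟩
  refine Integrable.of_bound (C := 1) ?_ (ae_of_all _ (norm_outerNormal_le Q))
  have hN : Measurable fun z => graphNormal R g (proj (R z)) :=
    (measurable_graphNormal R g).comp (by fun_prop)
  refine hN.aestronglyMeasurable.congr ?_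
  filter_upwards [ae_restrict_of_ae_restrict_of_subset hsub h.ae_outerNormal_eq,
    ae_restrict_mem hms] with z hz hzm
  exact (hz (hrW hzm.2)).symm

/-- Interior cone condition: near `x`, the downward cone of slope `K` at `x` stays in `Q`. It is
open and convex with `x` in its closure, which makes one-sided derivatives unique. -/
theorem uniqueDiffWithinAt (h : IsGraphChart Q W R K g) {x : E3}
    (hx : x ∈ W) (hxc : x ∈ closure Q) : UniqueDiffWithinAt ℝ (closure Q) x := by
  obtain ⟨r, hr, hrW⟩ := Metric.mem_nhds_iff.1 (h.isOpen.mem_nhds hx)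
  set cone : Set E3 := {y | R (y - x) 2 + K * ‖proj (R (y - x))‖ < 0} with hcone
  have hconv : Convex ℝ cone := by
    intro y hy z hz a b ha hb hab
    have e : a • y + b • z - x = a • (y - x) + b • (z - x) := by
      have hx1 : x = a • x + b • x := by rw [← add_smul, hab, one_smul]
      conv_lhs => rw [hx1]
      simp only [smul_sub]; abel
    simp only [hcone, mem_ofPred_eq] at hy hz ⊢
    rw [e]
    simp only [map_add, map_smul, PiLp.add_apply, PiLp.smul_apply, smul_eq_mul]
    have hn := norm_add_le (a • proj (R (y - x))) (b • proj (R (z - x)))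
    rw [norm_smul, norm_smul, Real.norm_of_nonneg ha, Real.norm_of_nonneg hb] at hn
    have hn2 := mul_le_mul_of_nonneg_left hn K.2
    rcases ha.eq_or_lt with rfl | ha
    · obtain rfl : b = 1 := by linarith
      simpa using hz
    · nlinarith [mul_lt_mul_of_pos_left hy ha, mul_le_mul_of_nonneg_left hz.le hb]
  have hopen : IsOpen cone := isOpen_lt (by fun_prop) (by fun_prop)
  have hsub : cone ∩ ball x r ⊆ closure Q := by
    rintro y ⟨hy, hyr⟩
    refine subset_closure ((h.mem_iff y (hrW hyr)).2 ?_)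
    have h1 := (h.mem_closure_iff hx).1 hxc
    have h2 := h.lipschitz.dist_le_mul (proj (R x)) (proj (R y))
    rw [dist_comm (proj (R x)), Real.dist_eq, dist_eq_norm, ← map_sub, ← map_sub] at h2
    have h3 := le_abs_self (g (proj (R x)) - g (proj (R y)))
    simp only [hcone, mem_ofPred_eq] at hy
    have h4 : R (y - x) 2 = R y 2 - R x 2 := by simp
    linarith
  have hcl : x ∈ closure (cone ∩ ball x r) := by
    have ht : Tendsto (fun t : ℝ => x - t • R.symm vert) (𝓝[>] 0) (𝓝 x) := by
      simpa using ((continuous_vertical_path R x).tendsto 0).mono_left nhdsWithin_le_nhds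
    refine mem_closure_of_tendsto ht ?_
    filter_upwards [ht.eventually (ball_mem_nhds x hr), self_mem_nhdsWithin] with t htb ht0
    refine ⟨?_, htb⟩
    have : (0 : ℝ) < t := ht0
    simp only [hcone, mem_ofPred_eq]
    simpa using this
  refine (uniqueDiffWithinAt_convex (hconv.inter (convex_ball x r)) ?_ hcl).mono hsub
  rw [(hopen.inter isOpen_ball).interior_eq]
  exact closure_nonempty_iff.1 ⟨x, hcl⟩

end IsGraphChart

/-! ### The divergence theorem on bounded Lipschitz domains. -/

theorem HasLipschitzBoundary.uniqueDiffOn_closure {Q : Set E3} (hQL : HasLipschitzBoundary Q)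
    (hQ : IsOpen Q) : UniqueDiffOn ℝ (closure Q) := by
  intro x hx
  by_cases hxQ : x ∈ Q
  · exact (hQ.uniqueDiffWithinAt hxQ).mono subset_closure
  · obtain ⟨W, R, K, g, hxW, h⟩ := hQL.exists_isGraphChart (x := x) (by
      rw [hQ.frontier_eq]; exact ⟨hx, hxQ⟩)
    exact h.uniqueDiffWithinAt hxW hx

theorem HasLipschitzBoundary.integrableOn_outerNormal {Q : Set E3} (hQL : HasLipschitzBoundary Q)
    (hQ : IsOpen Q) (hQb : Bornology.IsBounded Q) :
    IntegrableOn (outerNormal Q) (frontier Q) μHE[2] := by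
  have hcomp : IsCompact (frontier Q) :=
    hQb.isCompact_closure.of_isClosed_subset isClosed_frontier frontier_subset_closure
  refine LocallyIntegrableOn.integrableOn_isCompact (fun x hx => ?_) hcomp
  obtain ⟨W, R, K, g, hxW, h⟩ := hQL.exists_isGraphChart hx
  exact h.integrableAtFilter_outerNormal hQ hxW

theorem fderiv_eq_fderivWithin_closure {Q : Set E3} (hQ : IsOpen Q) (f : E3 → ℝ) {x : E3}
    (hx : x ∈ Q) : fderiv ℝ f x = fderivWithin ℝ f (closure Q) x :=
  (fderivWithin_of_mem_nhds (mem_of_superset (hQ.mem_nhds hx) subset_closure)).symm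

theorem _root_.ContDiffOn.contDiffAt_of_mem_open {Q : Set E3} (hQ : IsOpen Q) {n : WithTop ℕ∞}
    {F : Type*} [NormedAddCommGroup F] [NormedSpace ℝ F] {f : E3 → F}
    (hf : ContDiffOn ℝ n f (closure Q)) {x : E3} (hx : x ∈ Q) : ContDiffAt ℝ n f x :=
  hf.contDiffAt (mem_of_superset (hQ.mem_nhds hx) subset_closure)

theorem exists_bound_fderiv {Q : Set E3} (hQ : IsOpen Q) (hQb : Bornology.IsBounded Q)
    (hU : UniqueDiffOn ℝ (closure Q)) {f : E3 → ℝ} (hf : ContDiffOn ℝ 1 f (closure Q)) :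
    ∃ C : ℝ, ∀ x ∈ Q, ‖fderiv ℝ f x‖ ≤ C := by
  obtain ⟨C, hC⟩ := hQb.isCompact_closure.exists_bound_of_continuousOn
    (hf.continuousOn_fderivWithin hU le_rfl)
  exact ⟨C, fun x hx => by
    rw [fderiv_eq_fderivWithin_closure hQ f hx]; exact hC x (subset_closure hx)⟩

theorem integrableOn_of_continuousOn_closure {Q : Set E3} (hQb : Bornology.IsBounded Q)
    {f : E3 → ℝ} (hf : ContinuousOn f (closure Q)) : IntegrableOn f Q :=
  (hf.integrableOn_compact hQb.isCompact_closure).mono_set subset_closure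

theorem integrableOn_fderiv {Q : Set E3} (hQ : IsOpen Q) (hQb : Bornology.IsBounded Q)
    (hU : UniqueDiffOn ℝ (closure Q)) {f : E3 → ℝ} (hf : ContDiffOn ℝ 1 f (closure Q)) (v : E3) :
    IntegrableOn (fun x => fderiv ℝ f x v) Q := by
  refine (integrableOn_of_continuousOn_closure hQb
    ((hf.continuousOn_fderivWithin hU le_rfl).clm_apply (continuousOn_const (c := v)))).congr_fun ?_
    hQ.measurableSet
  intro x hx
  simp only [fderiv_eq_fderivWithin_closure hQ f hx]

theorem integrableOn_mul_inner_outerNormal {Q : Set E3} (hQL : HasLipschitzBoundary Q)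
    (hQ : IsOpen Q) (hQb : Bornology.IsBounded Q) {f : E3 → ℝ} (hf : ContinuousOn f (closure Q))
    (v : E3) :
    IntegrableOn (fun x => f x * inner ℝ v (outerNormal Q x)) (frontier Q) μHE[2] := by
  have hcomp : IsCompact (frontier Q) :=
    hQb.isCompact_closure.of_isClosed_subset isClosed_frontier frontier_subset_closure
  have h1 : IntegrableOn (fun x => inner ℝ v (outerNormal Q x)) (frontier Q) μHE[2] :=
    (hQL.integrableOn_outerNormal hQ hQb).const_inner v
  exact h1.continuousOn_mul (hf.mono frontier_subset_closure) hcomp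

/-- The divergence theorem for a field supported near a boundary point. -/
theorem IsGraphChart.integral_fderiv_mul {Q W : Set E3} {R : E3 ≃ₗᵢ[ℝ] E3} {K : NNReal}
    {g : E2 → ℝ} (h : IsGraphChart Q W R K g) (hQ : IsOpen Q) (hQb : Bornology.IsBounded Q)
    (hU : UniqueDiffOn ℝ (closure Q)) {φ f : E3 → ℝ} (hφ : ContDiff ℝ 1 φ)
    (hc : HasCompactSupport φ) (hφW : tsupport φ ⊆ W) (hf : ContDiffOn ℝ 1 f (closure Q)) (v : E3) :
    ∫ x in Q, fderiv ℝ (fun x => φ x * f x) x v =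
      ∫ x in frontier Q, φ x * f x * inner ℝ v (outerNormal Q x) ∂μHE[2] := by
  have hgc := h.lipschitz.continuous
  set G : E3 → ℝ := fun x => φ x * f x with hGdef
  have hz : ∀ x ∉ W, φ =ᶠ[𝓝 x] 0 := fun x hx =>
    notMem_tsupport_iff_eventuallyEq.1 fun hx' => hx (hφW hx')
  have hGz : ∀ x ∉ W, G =ᶠ[𝓝 x] fun _ => 0 := fun x hx => by
    filter_upwards [hz x hx] with y hy
    simp [G, hy]
  have hGcd : ContDiffOn ℝ 1 G (closure Q) := hφ.contDiffOn.mul hf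
  -- `f` is uncontrolled outside `closure Q`, but below the graph a point is either in `Q` or
  -- outside `W`, where `φ` vanishes locally.
  have hGat : ∀ x, R x ∈ below g → ContDiffAt ℝ 1 G x := by
    intro x hx
    by_cases hxW : x ∈ W
    · exact hGcd.contDiffAt_of_mem_open hQ ((h.mem_iff x hxW).2 hx)
    · exact contDiffAt_const.congr_of_eventuallyEq (hGz x hxW)
  have hGc : HasCompactSupport G := hc.mul_right
  rw [h.setIntegral_frontier hQ (fun x hx => (hGz x hx).self_of_nhds)]
  have hfd : ∀ z, fderiv ℝ (fun z => G (R.symm z)) z =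
      (fderiv ℝ G (R.symm z)).comp (R.symm : E3 →L[ℝ] E3) := fun z =>
    R.symm.toContinuousLinearEquiv.comp_right_fderiv (f := G) (x := z)
  obtain ⟨C, hC⟩ := exists_bound_fderiv hQ hQb hU hGcd
  -- `max C 0` also covers the points outside `W`, where the derivative is 0.
  have key := integral_below_fderiv h.lipschitz (G := fun z => G (R.symm z)) ?_ ?_ ?_
    (C := max C 0) ?_ (R v)
  · have e2 : ∫ z in below g, fderiv ℝ (fun z => G (R.symm z)) z (R v) =
        ∫ x in Q, fderiv ℝ G x v := by
      have hfd' : ∀ z, fderiv ℝ (fun z => G (R.symm z)) z (R v) = fderiv ℝ G (R.symm z) v :=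
        fun z => by rw [hfd]; simp
      simp only [hfd']
      have hpre : below g = R.symm ⁻¹' (R ⁻¹' below g) := by ext z; simp
      rw [hpre, R.symm.measurePreserving.setIntegral_preimage_emb
        R.symm.toHomeomorph.measurableEmbedding (fun x => fderiv ℝ G x v),
        ← integral_indicator hQ.measurableSet, ← integral_indicator
          ((isOpen_below hgc).preimage R.continuous).measurableSet]
      congr 1
      funext x
      by_cases hx : x ∈ W
      · have hiff : x ∈ Q ↔ x ∈ R ⁻¹' below g := h.mem_iff x hx
        by_cases hxQ : x ∈ Q
        · rw [indicator_of_mem hxQ, indicator_of_mem (hiff.1 hxQ)]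
        · rw [indicator_of_notMem hxQ, indicator_of_notMem (mt hiff.2 hxQ)]
      · have : fderiv ℝ G x v = 0 := by rw [(hGz x hx).fderiv_eq]; simp
        simp [indicator, this]
    rw [← e2, key]
    rfl
  · intro z hz
    exact ((hGat (R.symm z) (by simpa using hz)).comp z
      R.symm.contDiff.contDiffAt).contDiffWithinAt
  · intro z hz
    by_cases hzW : R.symm z ∈ W
    · have hcl : R.symm z ∈ closure Q := (h.mem_closure_iff hzW).2 (by simpa using hz)
      have h1 := hGcd.continuousOn _ hcl
      refine (h1.comp_of_preimage_mem_nhdsWithin (f := R.symm) (s := {z | z 2 ≤ g (proj z)})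
        R.symm.continuous.continuousWithinAt ?_)
      filter_upwards [self_mem_nhdsWithin, mem_nhdsWithin_of_mem_nhds
        ((h.isOpen.preimage R.symm.continuous).mem_nhds hzW)] with y hy hyW
      exact (h.mem_closure_iff hyW).2 (by simpa using hy)
    · exact ((continuousAt_const.congr (hGz _ hzW).symm).comp
        R.symm.continuous.continuousAt).continuousWithinAt
  · exact hGc.comp_homeomorph R.symm.toHomeomorph
  · intro z hz
    rw [hfd, ContinuousLinearMap.opNorm_comp_linearIsometryEquiv]
    by_cases hzW : R.symm z ∈ W
    · exact (hC _ ((h.mem_iff _ hzW).2 (by simpa [below] using hz))).trans (le_max_left _ _)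
    · rw [(hGz _ hzW).fderiv_eq]; simp

/-- The product is C¹ with compact support in the whole space and vanishes on the boundary, so both
sides are 0. -/
theorem integral_fderiv_mul_of_tsupport_subset {Q : Set E3} (hQ : IsOpen Q) {φ f : E3 → ℝ}
    (hφ : ContDiff ℝ 1 φ) (hc : HasCompactSupport φ) (hφQ : tsupport φ ⊆ Q)
    (hf : ContDiffOn ℝ 1 f (closure Q)) (v : E3) :
    ∫ x in Q, fderiv ℝ (fun x => φ x * f x) x v =
      ∫ x in frontier Q, φ x * f x * inner ℝ v (outerNormal Q x) ∂μHE[2] := by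
  have hGz : ∀ x ∉ Q, (fun x => φ x * f x) =ᶠ[𝓝 x] fun _ => 0 := fun x hx => by
    filter_upwards [notMem_tsupport_iff_eventuallyEq.1 fun hx' => hx (hφQ hx')] with y hy
    simp [hy]
  have hG : ContDiff ℝ 1 fun x => φ x * f x := by
    rw [contDiff_iff_contDiffAt]
    intro x
    by_cases hx : x ∈ Q
    · exact hφ.contDiffAt.mul (hf.contDiffAt_of_mem_open hQ hx)
    · exact contDiffAt_const.congr_of_eventuallyEq (hGz x hx)
  have hGc : HasCompactSupport fun x => φ x * f x := hc.mul_right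
  have h1 : ∫ x in frontier Q, φ x * f x * inner ℝ v (outerNormal Q x) ∂μHE[2] = 0 := by
    refine setIntegral_eq_zero_of_forall_eq_zero fun x hx => ?_
    rw [hQ.frontier_eq] at hx
    have h0 : φ x * f x = 0 := (hGz x hx.2).self_of_nhds
    rw [h0, zero_mul]
  rw [h1, setIntegral_eq_integral_of_forall_compl_eq_zero fun x hx => by
    rw [(hGz x hx).fderiv_eq]; simp]
  obtain ⟨C, hC⟩ := hG.lipschitzWith_of_hasCompactSupport hGc one_ne_zero
  rw [← integral_lineDeriv_eq_zero (μ := volume) hC hGc v]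
  exact integral_congr_ae (ae_of_all _ fun x =>
    ((hG.differentiable one_ne_zero x).lineDeriv_eq_fderiv).symm)

/-- The divergence theorem on a bounded Lipschitz domain, for a field of constant direction. -/
theorem integral_fderiv_eq_integral_frontier {Q : Set E3} (hQL : HasLipschitzBoundary Q)
    (hQ : IsOpen Q) (hQb : Bornology.IsBounded Q) {f : E3 → ℝ} (hf : ContDiffOn ℝ 1 f (closure Q))
    (v : E3) :
    ∫ x in Q, fderiv ℝ f x v =
      ∫ x in frontier Q, f x * inner ℝ v (outerNormal Q x) ∂μHE[2] := by
  have hU := hQL.uniqueDiffOn_closure hQ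
  have hloc : ∀ x : closure Q, ∃ W : Set E3, IsOpen W ∧ (x : E3) ∈ W ∧ Bornology.IsBounded W ∧
      ∀ φ : E3 → ℝ, ContDiff ℝ 1 φ → HasCompactSupport φ → tsupport φ ⊆ W →
        ∫ x in Q, fderiv ℝ (fun x => φ x * f x) x v =
          ∫ x in frontier Q, φ x * f x * inner ℝ v (outerNormal Q x) ∂μHE[2] := by
    rintro ⟨x, hx⟩
    by_cases hxQ : x ∈ Q
    · exact ⟨Q, hQ, hxQ, hQb, fun φ hφ hc hs =>
        integral_fderiv_mul_of_tsupport_subset hQ hφ hc hs hf v⟩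
    · obtain ⟨W, R, K, g, hxW, h⟩ := hQL.exists_isGraphChart (x := x) (by
        rw [hQ.frontier_eq]; exact ⟨hx, hxQ⟩)
      -- The ball makes the neighbourhood bounded, so the partition functions have compact support.
      exact ⟨W ∩ ball x 1, h.isOpen.inter isOpen_ball, ⟨hxW, mem_ball_self one_pos⟩,
        isBounded_ball.subset inter_subset_right, fun φ hφ hc hs =>
        h.integral_fderiv_mul hQ hQb hU hφ hc (hs.trans inter_subset_left) hf v⟩
  choose W hWo hxW hWb hW using hloc
  obtain ⟨ρ, hρ⟩ := SmoothPartitionOfUnity.exists_isSubordinate 𝓘(ℝ, E3)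
    (isClosed_closure (s := Q)) W hWo fun x hx => mem_iUnion.2 ⟨⟨x, hx⟩, hxW _⟩
  have hρs : ∀ i, ContDiff ℝ 1 (ρ i) := fun i =>
    (ρ i).contMDiff.contDiff.of_le (by exact_mod_cast le_top)
  have hρc : ∀ i, HasCompactSupport (ρ i) := fun i =>
    isCompact_of_isClosed_isBounded (isClosed_tsupport _) ((hWb i).subset (hρ i))
  have hfin := ρ.locallyFinite.finite_nonempty_inter_compact hQb.isCompact_closure
  set I := hfin.toFinset with hI
  have hsum : ∀ x ∈ closure Q, ∑ i ∈ I, ρ i x = 1 := by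
    intro x hx
    rw [← ρ.sum_eq_one hx, eq_comm]
    refine finsum_eq_sum_of_support_subset _ fun i hi => ?_
    simp only [hI, Finite.coe_toFinset, mem_ofPred_eq]
    exact ⟨x, hi, hx⟩
  have hmul : ∀ i, ContDiffOn ℝ 1 (fun x => ρ i x * f x) (closure Q) := fun i =>
    (hρs i).contDiffOn.mul hf
  have hL : ∫ x in Q, fderiv ℝ f x v = ∑ i ∈ I, ∫ x in Q, fderiv ℝ (fun x => ρ i x * f x) x v := by
    rw [← integral_finsetSum I fun i _ => integrableOn_fderiv hQ hQb hU (hmul i) v]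
    refine setIntegral_congr_fun hQ.measurableSet fun x hx => ?_
    have he : f =ᶠ[𝓝 x] fun x => ∑ i ∈ I, ρ i x * f x := by
      filter_upwards [hQ.mem_nhds hx] with y hy
      rw [← Finset.sum_mul, hsum y (subset_closure hy), one_mul]
    simp only [he.fderiv_eq]
    rw [fderiv_fun_sum fun i _ =>
      ((hmul i).contDiffAt_of_mem_open hQ hx).differentiableAt one_ne_zero]
    simp
  have hR : ∫ x in frontier Q, f x * inner ℝ v (outerNormal Q x) ∂μHE[2] =
      ∑ i ∈ I, ∫ x in frontier Q, ρ i x * f x * inner ℝ v (outerNormal Q x) ∂μHE[2] := by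
    rw [← integral_finsetSum I fun i _ =>
      integrableOn_mul_inner_outerNormal hQL hQ hQb (hmul i).continuousOn v]
    refine setIntegral_congr_fun isClosed_frontier.measurableSet fun x hx => ?_
    rw [← Finset.sum_mul, ← Finset.sum_mul, hsum x (frontier_subset_closure hx), one_mul]
  rw [hL, hR]
  exact Finset.sum_congr rfl fun i _ => hW i _ (hρs i) (hρc i) (hρ i)

/-! ### Symmetry of second derivatives and the divergence of the flux field. -/

section PartialDerivatives

variable {Q : Set E3}

theorem contDiffOn_pd (hU : UniqueDiffOn ℝ (closure Q)) {f : E3 → ℝ}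
    (hf : ContDiffOn ℝ 2 f (closure Q)) (i : Fin 3) :
    ContDiffOn ℝ 1 (pd (closure Q) i f) (closure Q) :=
  (hf.fderivWithin hU (m := 1) (by norm_num)).clm_apply contDiffOn_const

theorem continuousOn_pd (hU : UniqueDiffOn ℝ (closure Q)) {f : E3 → ℝ}
    (hf : ContDiffOn ℝ 1 f (closure Q)) (i : Fin 3) :
    ContinuousOn (pd (closure Q) i f) (closure Q) :=
  (hf.continuousOn_fderivWithin hU le_rfl).clm_apply continuousOn_const

theorem fderiv_single_eq_pd (hQ : IsOpen Q) {x : E3} (hx : x ∈ Q) (f : E3 → ℝ) (i : Fin 3) :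
    fderiv ℝ f x (EuclideanSpace.single i 1) = pd (closure Q) i f x := by
  rw [pd, fderiv_eq_fderivWithin_closure hQ f hx]

/-- Near an interior point `pd` is the ordinary partial derivative, so Schwarz's theorem applies. -/
theorem fderiv_pd_comm (hQ : IsOpen Q) {f : E3 → ℝ} (hf : ContDiffOn ℝ 2 f (closure Q)) {x : E3}
    (hx : x ∈ Q) (i k : Fin 3) :
    fderiv ℝ (pd (closure Q) i f) x (EuclideanSpace.single k 1) =
      fderiv ℝ (pd (closure Q) k f) x (EuclideanSpace.single i 1) := by
  have hfx := hf.contDiffAt_of_mem_open hQ hx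
  have hd : DifferentiableAt ℝ (fderiv ℝ f) x :=
    (hfx.fderiv_right (m := 1) (by norm_num)).differentiableAt one_ne_zero
  have h : ∀ j l : Fin 3, fderiv ℝ (pd (closure Q) j f) x (EuclideanSpace.single l 1) =
      fderiv ℝ (fderiv ℝ f) x (EuclideanSpace.single l 1) (EuclideanSpace.single j 1) := by
    intro j l
    have he : pd (closure Q) j f =ᶠ[𝓝 x] fun y => fderiv ℝ f y (EuclideanSpace.single j 1) := by
      filter_upwards [hQ.mem_nhds hx] with y hy
      rw [fderiv_single_eq_pd hQ hy]
    rw [he.fderiv_eq, (hd.hasFDerivAt.clm_apply (hasFDerivAt_const _ x)).fderiv]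
    simp
  rw [h, h]
  exact (hfx.isSymmSndFDerivAt (by simp)).eq _ _

end PartialDerivatives

/-- The field `w · ∇u - w (∇ · u)` whose divergence is `∂ₖ wᵢ ∂ᵢ uₖ - (∇ · w)(∇ · u)`. -/
def fluxField (A : Set E3) (w u : E3 → E3) (k : Fin 3) (x : E3) : ℝ :=
  ∑ i, (w x i * pd A i (fun y => u y k) x - w x k * pd A i (fun y => u y i) x)

section FluxField

variable {Q : Set E3} {w u : E3 → E3}

theorem contDiffOn_fluxField (hU : UniqueDiffOn ℝ (closure Q)) (hw : ContDiffOn ℝ 1 w (closure Q))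
    (hu : ContDiffOn ℝ 2 u (closure Q)) (k : Fin 3) :
    ContDiffOn ℝ 1 (fluxField (closure Q) w u k) (closure Q) := by
  have hw' := contDiffOn_euclidean.1 hw
  have hu' := contDiffOn_euclidean.1 hu
  exact ContDiffOn.sum fun i _ => ((hw' i).mul (contDiffOn_pd hU (hu' k) i)).sub
    ((hw' k).mul (contDiffOn_pd hU (hu' i) i))

theorem sum_fderiv_fluxField (hQ : IsOpen Q) (hU : UniqueDiffOn ℝ (closure Q))
    (hw : ContDiffOn ℝ 1 w (closure Q)) (hu : ContDiffOn ℝ 2 u (closure Q)) {x : E3} (hx : x ∈ Q) :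
    ∑ k, fderiv ℝ (fluxField (closure Q) w u k) x (EuclideanSpace.single k 1) =
      (∑ i, ∑ k, pd (closure Q) k (fun y => w y i) x * pd (closure Q) i (fun y => u y k) x) -
        divg (closure Q) w x * divg (closure Q) u x := by
  have hw' := contDiffOn_euclidean.1 hw
  have hu' := contDiffOn_euclidean.1 hu
  have hwd : ∀ i, HasFDerivAt (fun y => w y i) (fderiv ℝ (fun y => w y i) x) x := fun i =>
    (((hw' i).contDiffAt_of_mem_open hQ hx).differentiableAt one_ne_zero).hasFDerivAt
  have hpd : ∀ i j, HasFDerivAt (pd (closure Q) i fun y => u y j)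
      (fderiv ℝ (pd (closure Q) i fun y => u y j) x) x := fun i j =>
    (((contDiffOn_pd hU (hu' j) i).contDiffAt_of_mem_open hQ hx).differentiableAt
      one_ne_zero).hasFDerivAt
  have hF : ∀ k, fderiv ℝ (fluxField (closure Q) w u k) x (EuclideanSpace.single k 1) =
      ∑ i, ((w x i * fderiv ℝ (pd (closure Q) i fun y => u y k) x (EuclideanSpace.single k 1) +
          pd (closure Q) i (fun y => u y k) x * pd (closure Q) k (fun y => w y i) x) -
        (w x k * fderiv ℝ (pd (closure Q) i fun y => u y i) x (EuclideanSpace.single k 1) +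
          pd (closure Q) i (fun y => u y i) x * pd (closure Q) k (fun y => w y k) x)) := by
    intro k
    have h : HasFDerivAt (fluxField (closure Q) w u k) _ x := HasFDerivAt.fun_sum fun i _ =>
      ((hwd i).mul (hpd i k)).sub ((hwd k).mul (hpd i i))
    rw [h.fderiv]
    simp [fderiv_single_eq_pd hQ hx]
  simp only [hF, divg]
  rw [Finset.sum_mul_sum]
  simp only [Finset.sum_sub_distrib, Finset.sum_add_distrib]
  -- Cancellation of the second-order terms: exchange the names of `i` and `k`, then commute the
  -- derivatives of `u`.
  have h1 : ∑ k, ∑ i, w x i *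
        fderiv ℝ (pd (closure Q) i fun y => u y k) x (EuclideanSpace.single k 1) =
      ∑ k, ∑ i, w x k *
        fderiv ℝ (pd (closure Q) i fun y => u y i) x (EuclideanSpace.single k 1) := by
    rw [Finset.sum_comm]
    exact Finset.sum_congr rfl fun i _ => Finset.sum_congr rfl fun k _ => by
      rw [fderiv_pd_comm hQ (hu' k) hx]
  have h2 : ∑ k, ∑ i, pd (closure Q) i (fun y => u y k) x * pd (closure Q) k (fun y => w y i) x =
      ∑ i, ∑ k, pd (closure Q) k (fun y => w y i) x * pd (closure Q) i (fun y => u y k) x := by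
    rw [Finset.sum_comm]
    simp only [mul_comm]
  have h3 : ∑ k, ∑ i, pd (closure Q) i (fun y => u y i) x * pd (closure Q) k (fun y => w y k) x =
      ∑ k, ∑ i, pd (closure Q) k (fun y => w y k) x * pd (closure Q) i (fun y => u y i) x := by
    simp only [mul_comm]
  rw [h1, h2, h3]
  ring

end FluxField

end Acoustic
end


/-- Below, `w` is the steady advection velocity, `u` the acoustic velocity fluctuation (at a fixed
time), and `μHE[2]` is the two-dimensional Hausdorff measure normalized as surface area. -/
theorem lemma1 (Q : Set Acoustic.E3) (hQ : IsOpen Q) (hQb : Bornology.IsBounded Q)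
    (hQL : Acoustic.HasLipschitzBoundary Q)
    (w u : Acoustic.E3 → Acoustic.E3)
    (hw : ContDiffOn ℝ 1 w (closure Q)) (hu : ContDiffOn ℝ 2 u (closure Q)) :
    IntegrableOn (fun x => ∑ i, ∑ k,
        Acoustic.pd (closure Q) k (fun y => w y i) x *
          Acoustic.pd (closure Q) i (fun y => u y k) x) Q volume ∧
    IntegrableOn (fun x => ∑ k, (∑ i,
        (w x i * Acoustic.pd (closure Q) i (fun y => u y k) x -
          w x k * Acoustic.pd (closure Q) i (fun y => u y i) x)) *
        Acoustic.outerNormal Q x k) (frontier Q) (μHE[2]) ∧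
    IntegrableOn (fun x => Acoustic.divg (closure Q) w x * Acoustic.divg (closure Q) u x)
      Q volume ∧
    ∫ x in Q, ∑ i, ∑ k,
        Acoustic.pd (closure Q) k (fun y => w y i) x *
          Acoustic.pd (closure Q) i (fun y => u y k) x =
      (∫ x in frontier Q, ∑ k, (∑ i,
        (w x i * Acoustic.pd (closure Q) i (fun y => u y k) x -
          w x k * Acoustic.pd (closure Q) i (fun y => u y i) x)) *
        Acoustic.outerNormal Q x k ∂μHE[2]) +
      ∫ x in Q, Acoustic.divg (closure Q) w x * Acoustic.divg (closure Q) u x := by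
  have hU := hQL.uniqueDiffOn_closure hQ
  have hw' := contDiffOn_euclidean.1 hw
  have hu' := contDiffOn_euclidean.1 hu
  have hwp : ∀ i k, ContinuousOn (Acoustic.pd (closure Q) k fun y => w y i) (closure Q) :=
    fun i k => Acoustic.continuousOn_pd hU (hw' i) k
  have hup : ∀ i k, ContinuousOn (Acoustic.pd (closure Q) k fun y => u y i) (closure Q) :=
    fun i k => Acoustic.continuousOn_pd hU ((hu' i).of_le (by norm_num)) k
  have hA := Acoustic.integrableOn_of_continuousOn_closure hQb
    (f := fun x => ∑ i, ∑ k, Acoustic.pd (closure Q) k (fun y => w y i) x *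
      Acoustic.pd (closure Q) i (fun y => u y k) x)
    (continuousOn_finsetSum _ fun i _ => continuousOn_finsetSum _ fun k _ =>
      (hwp i k).mul (hup k i))
  have hC := Acoustic.integrableOn_of_continuousOn_closure hQb
    (f := fun x => Acoustic.divg (closure Q) w x * Acoustic.divg (closure Q) u x)
    ((continuousOn_finsetSum _ fun i _ => hwp i i).mul
      (continuousOn_finsetSum _ fun i _ => hup i i))
  have hF := Acoustic.contDiffOn_fluxField hU hw hu
  have hinner : ∀ k x, inner ℝ (EuclideanSpace.single k (1 : ℝ)) (Acoustic.outerNormal Q x) =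
      Acoustic.outerNormal Q x k := fun k x => by
    rw [EuclideanSpace.inner_single_left, map_one, one_mul]
  have hB : ∀ k, IntegrableOn (fun x => Acoustic.fluxField (closure Q) w u k x *
      Acoustic.outerNormal Q x k) (frontier Q) μHE[2] := fun k => by
    simpa only [hinner] using Acoustic.integrableOn_mul_inner_outerNormal hQL hQ hQb
      (hF k).continuousOn (EuclideanSpace.single k 1)
  refine ⟨hA, integrable_finsetSum _ fun k _ => hB k, hC, ?_⟩
  -- With the divergence product moved to the left, the integrand is the divergence of `fluxField`.
  rw [← sub_eq_iff_eq_add, ← integral_sub hA hC]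
  refine Eq.trans ?_ (integral_finsetSum _ fun k _ => hB k).symm
  -- The divergence theorem for each component `F_k` in the direction of the `k`-th basis vector.
  have hdiv : ∀ k, ∫ x in frontier Q, Acoustic.fluxField (closure Q) w u k x *
      Acoustic.outerNormal Q x k ∂μHE[2] =
      ∫ x in Q, fderiv ℝ (Acoustic.fluxField (closure Q) w u k) x
        (EuclideanSpace.single k 1) := fun k => by
    simpa only [hinner] using
      (Acoustic.integral_fderiv_eq_integral_frontier hQL hQ hQb (hF k)
        (EuclideanSpace.single k 1)).symm
  rw [Finset.sum_congr rfl fun k _ => hdiv k, ← integral_finsetSum _ fun k _ =>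
    Acoustic.integrableOn_fderiv hQ hQb hU (hF k) _]
  exact setIntegral_congr_fun hQ.measurableSet fun x hx =>
    (Acoustic.sum_fderiv_fluxField hQ hU hw hu hx).symm
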